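/- **Theorem.** Consider $n$ nodes and a generating vector $\pi=(\pi_1,\dots,\pi_n)$ with all $\pi_i\ge 0$ and not all $\pi_i$ equal to $0$. In every step $s=0,1,2,\dots$ node $i$ generates a random number of new items, with a Bernoulli or a Poisson distribution of mean $\pi_i$ (the same distribution in every step), independently over nodes and steps. A (random) 1-schedule $\mathcal S$ probes one node $\mathcal S(t)$ at each time $t=1,2,\dots$; a probe of node $i$ at time $t$ discovers all items generated at node $i$ in steps up to $t-1$. Let $Q^{\mathcal S}(t)$ be the total number of undiscovered items at time $t$ (immediately before the probe of time $t$), and let $$\mathrm{cost}(\mathcal S,\pi)=\lim_{t\to\infty}\frac1t\sum_{t'=1}^{t}\mathbb E\big[Q^{\mathcal S}(t')\big].$$ A 1-schedule is *memoryless* with probability vector $p$ if at each step it probes node $i$ with probability $p_i$, independently of any other event. The algorithm Adaptive does not know $\pi$. It starts with counters $c_i=0$ and estimates $\tilde\pi_i=1$ for all $i$. At each time $t=1,2,\dots$ it probes a node $i_0$, drawn with fresh randomness from the distribution $p_i(t)=\sqrt{\tilde\pi_i}\big/\sum_{j}\sqrt{\tilde\pi_j}$; it then adds to $c_{i_0}$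 the number of new items caught at $i_0$ by this probe, and sets $\tilde\pi_{i_0}\leftarrow \max(1,c_{i_0})/t$. Let $\mathcal A$ be the 1-schedule produced by Adaptive, and let $\mathcal R$ be the memoryless 1-schedule with probabilities $p^*_i=\sqrt{\pi_i}\big/\sum_{j}\sqrt{\pi_j}$. Then $\mathcal R$ is an optimal memoryless 1-schedule, that is, its cost is at most that of every memoryless 1-schedule. The schedule $\mathcal A$ converges to $\mathcal R$: the expectations $\mathbb E[Q^{\mathcal A}(t)]$ and $\mathbb E[Q^{\mathcal R}(t)]$ are finite for all $t$, and $$\lim_{t\to\infty}\big|\mathbb E[Q^{\mathcal A}(t)]-\mathbb E[Q^{\mathcal R}(t)]\big|=0 .$$ Consequently the limits that define the two costs exist, and $\mathrm{cost}(\mathcal A,\pi)=\mathrm{cost}(\mathcal R,\pi)=\Big(\sum_{i=1}^n\sqrt{\pi_i}\Big)^2$. -/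

import Mathlib

open MeasureTheory ProbabilityTheory Filter Topology
open scoped ENNReal NNReal unitInterval

universe u v w

namespace Probing

/-! ### The combinatorial model: item counts, probes, undiscovered items

A realisation of the generating process is `x : ℕ → Fin n → ℕ`, where `x s i` is the number of
items generated at node `i` in step `s = 0, 1, 2, …`.  A realisation of a 1-schedule is
`a : ℕ → Fin n`, where `a t` is the node probed at time `t = 1, 2, …` (the value `a 0` is never
used).  A probe of node `i` at time `t` discovers all items generated at `i` in steps `< t`. -/

/-- The number of undiscovered items at node `i` and time `t` (immediately before the probe of time
`t`): the items generated at `i` in a step `s < t` such that no probe of `i` took place at a time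
`r` with `s < r < t`. -/
def undiscovered {n : ℕ} (x : ℕ → Fin n → ℕ) (a : ℕ → Fin n) (t : ℕ) (i : Fin n) : ℕ :=
  ∑ s ∈ Finset.range t, if ∃ r ∈ Finset.Ioo s t, a r = i then 0 else x s i

/-- The total number of undiscovered items at time `t`. -/
def totalUndiscovered {n : ℕ} (x : ℕ → Fin n → ℕ) (a : ℕ → Fin n) (t : ℕ) : ℕ :=
  ∑ i, undiscovered x a t i

/-! ### Random item processes and random schedules -/

/-- `IsItemLaw r ρ`: the law `ρ` of the number of items generated in a step is Bernoulli or Poisson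
with expected value `r`. -/
inductive IsItemLaw : ℝ → Measure ℕ → Prop
  | bernoulli (p : I) : IsItemLaw (p : ℝ) (bernoulliMeasure 1 0 p)
  | poisson (r : ℝ≥0) : IsItemLaw (r : ℝ) (poissonMeasure r)

/-- `X s i` is the random number of items generated at node `i` in step `s`: a static generating
process with generating vector `π`, independent over nodes and steps. -/
structure IsItemProcess {n : ℕ} {Ω : Type u} [MeasurableSpace Ω] (μ : Measure Ω)
    (π : Fin n → ℝ) (X : ℕ → Fin n → Ω → ℕ) : Prop where
  measurable : ∀ s i, Measurable (X s i)
  law : ∀ i, ∃ ρ, IsItemLaw (π i) ρ ∧ ∀ s, μ.map (X s i) = ρ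
  indep : iIndepFun (fun k : ℕ × Fin n => X k.1 k.2) μ

/-- The σ-algebra generated by the whole item process and by the probes at times `1, …, t`. -/
@[reducible] def history {n : ℕ} {Ω : Type u} (X : ℕ → Fin n → Ω → ℕ) (S : ℕ → Ω → Fin n) (t : ℕ) :
    MeasurableSpace Ω :=
  (⨆ s, ⨆ i, MeasurableSpace.comap (X s i) inferInstance) ⊔
    ⨆ r ∈ Finset.Icc 1 t, MeasurableSpace.comap (S r) inferInstance

/-- The random 1-schedule `S` is driven by `rule`: given the item process and the probes at times
`1, …, t`, the probe at time `t + 1` is drawn from the distribution `rule x a t` on the nodes, where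
`x` and `a` are the realised item counts and probes.  Since the conditioning is on the whole item
process, the draw uses fresh randomness that is independent of everything else. -/
structure IsDrivenBy {n : ℕ} {Ω : Type u} [MeasurableSpace Ω] (μ : Measure Ω)
    (rule : (ℕ → Fin n → ℕ) → (ℕ → Fin n) → ℕ → Fin n → ℝ)
    (X : ℕ → Fin n → Ω → ℕ) (S : ℕ → Ω → Fin n) : Prop where
  measurable : ∀ t, Measurable (S t)
  condProb : ∀ t i, μ⟦S (t + 1) ⁻¹' {i} | history X S t⟧
    =ᵐ[μ] fun ω => rule (fun s j => X s j ω) (fun r => S r ω) t i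

/-- The random schedule `S` is the memoryless 1-schedule defined by the probability vector `p`: at
each step node `i` is probed with probability `p i`, independently of any other event. -/
structure IsMemoryless {n : ℕ} {Ω : Type u} [MeasurableSpace Ω] (μ : Measure Ω)
    (p : Fin n → ℝ) (X : ℕ → Fin n → Ω → ℕ) (S : ℕ → Ω → Fin n) : Prop where
  mem_stdSimplex : p ∈ stdSimplex ℝ (Fin n)
  drivenBy : IsDrivenBy μ (fun _ _ _ => p) X S

/-! ### Expected number of undiscovered items, cost, convergence, optimality -/

/-- The expected number `E[Q(t)]` of undiscovered items at time `t`, in `[0, ∞]`. -/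
noncomputable def expectedUndiscovered {n : ℕ} {Ω : Type u} [MeasurableSpace Ω] (μ : Measure Ω)
    (X : ℕ → Fin n → Ω → ℕ) (S : ℕ → Ω → Fin n) (t : ℕ) : ℝ≥0∞ :=
  ∫⁻ ω, (totalUndiscovered (fun s j => X s j ω) (fun r => S r ω) t : ℝ≥0∞) ∂μ

/-- The schedule has cost `c ∈ [0, ∞]`: `(1 / t) ∑_{t' = 1}^t E[Q(t')] → c` as `t → ∞`. -/
def HasCost {n : ℕ} {Ω : Type u} [MeasurableSpace Ω] (μ : Measure Ω)
    (X : ℕ → Fin n → Ω → ℕ) (S : ℕ → Ω → Fin n) (c : ℝ≥0∞) : Prop :=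
  Tendsto (fun t : ℕ => (∑ t' ∈ Finset.Icc 1 t, expectedUndiscovered μ X S t') / (t : ℝ≥0∞))
    atTop (𝓝 c)

/-- `|E[Q^S(t)] - E[Q^S'(t)]| → 0` as `t → ∞`, all these expectations being finite. -/
def Converges {n : ℕ} {Ω : Type u} [MeasurableSpace Ω] (μ : Measure Ω)
    (X : ℕ → Fin n → Ω → ℕ) (S : ℕ → Ω → Fin n)
    {Ω' : Type v} [MeasurableSpace Ω'] (μ' : Measure Ω')
    (X' : ℕ → Fin n → Ω' → ℕ) (S' : ℕ → Ω' → Fin n) : Prop :=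
  (∀ t, expectedUndiscovered μ X S t ≠ ∞) ∧ (∀ t, expectedUndiscovered μ' X' S' t ≠ ∞) ∧
    Tendsto (fun t => |(expectedUndiscovered μ X S t).toReal -
      (expectedUndiscovered μ' X' S' t).toReal|) atTop (𝓝 0)

/-- `R` is an optimal memoryless 1-schedule for the generating vector `π`: it is memoryless, and its
cost is at most the cost of every memoryless 1-schedule in a system with generating vector `π`. -/
def IsOptimalMemoryless {n : ℕ} {Ω : Type u} [MeasurableSpace Ω] (μ : Measure Ω)
    (π : Fin n → ℝ) (X : ℕ → Fin n → Ω → ℕ) (R : ℕ → Ω → Fin n) : Prop :=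
  (∃ p, IsMemoryless μ p X R) ∧
  ∃ c, HasCost μ X R c ∧
    ∀ (Ω' : Type v) (_ : MeasurableSpace Ω') (μ' : Measure Ω') (_ : IsProbabilityMeasure μ')
      (X' : ℕ → Fin n → Ω' → ℕ) (S : ℕ → Ω' → Fin n) (q : Fin n → ℝ) (c' : ℝ≥0∞),
      IsItemProcess μ' π X' → IsMemoryless μ' q X' S → HasCost μ' X' S c' → c ≤ c'

/-- The probability vector proportional to `√(w i)`. -/
noncomputable def sqrtProbs {n : ℕ} (w : Fin n → ℝ) (i : Fin n) : ℝ :=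
  √(w i) / ∑ j, √(w j)

/-! ### The algorithm Adaptive -/

/-- The counters `c_i` after the first `t` iterations: initially `0`; the iteration of time `t + 1`,
which probes `i₀ = a (t + 1)`, adds the number of new items caught at `i₀` to `c_{i₀}`. -/
def caught {n : ℕ} (x : ℕ → Fin n → ℕ) (a : ℕ → Fin n) : ℕ → Fin n → ℕ
  | 0 => fun _ => 0
  | t + 1 => Function.update (caught x a t) (a (t + 1))
      (caught x a t (a (t + 1)) + undiscovered x a (t + 1) (a (t + 1)))

/-- The estimates of `π_i` after the first `t` iterations: initially `1`; the iteration of time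
`t + 1`, which probes `i₀ = a (t + 1)`, replaces the estimate at `i₀` by
`max (1, c_{i₀}) / (t + 1)`. -/
noncomputable def estimate {n : ℕ} (x : ℕ → Fin n → ℕ) (a : ℕ → Fin n) : ℕ → Fin n → ℝ
  | 0 => fun _ => 1
  | t + 1 => Function.update (estimate x a t) (a (t + 1))
      (max 1 (caught x a (t + 1) (a (t + 1)) : ℝ) / ((t : ℝ) + 1))

/-- The random schedule `A` is an output of the algorithm Adaptive on the item process `X`: given
the past, the probe at time `t + 1` is node `i` with probability proportional to the square root of
the estimate of `π_i` after `t` iterations. -/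
def IsAdaptive {n : ℕ} {Ω : Type u} [MeasurableSpace Ω] (μ : Measure Ω)
    (X : ℕ → Fin n → Ω → ℕ) (A : ℕ → Ω → Fin n) : Prop :=
  IsDrivenBy μ (fun x a t => sqrtProbs (estimate x a t)) X A

end Probing

/-! An item of age `k` is undiscovered exactly when its node was missed by the last `k` probes.
Hence `E[Q(t)]` is a sum over nodes `i` and ages `k < t` of the mean of `X s i` on the event that
`i` is not probed in `(s, s + k]`, where `s = t - 1 - k` (`IsItemProcess.expectedUndiscovered_eq`).
For a memoryless schedule the term is `(1 - p i) ^ k * π i`, so node `i` contributes `π i / p i` in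
the limit. Cauchy–Schwarz bounds the sum of these below by `(∑ √(π i)) ^ 2`, with equality at
`sqrtProbs π`.

For Adaptive it suffices to show that each node has the same limit
(`IsAdaptive.tendsto_meanUndiscovered`). This is dominated convergence for the sum over `k`, and
needs two facts.

Termwise limit. By conservation of items, the estimate made when a node is probed at time `τ` is
`max 1 (itemSum) / τ`, which tends to `π i` by the strong law, provided the node is probed
infinitely often. It is, because an estimate at time `t` is never below `1 / t`: unless some running
average exceeds `√T`, every probe in `(T, 2T]` hits a given node with probability at least of order
`T ^ (-3/4)`, so missing it throughout has probability at most `exp (-c * T ^ (1/4))`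
(`IsAdaptive.measureReal_noProbe_le`), and Borel–Cantelli applies. Hence the conditional probe
probabilities converge almost surely to `sqrtProbs π`, and for fixed `k` the term converges to `(1 -
p) ^ k * π i`.

Summable domination (`IsAdaptive.setIntegral_noProbe_le_of_badEvent`). Outside a bad event of
probability `O(T ^ (-4))`, with `T = t / 4`, node `i` is probed with conditional probability at
least a constant `δ` from time `2T` on. An item of age `k` at time `t` has lived through at least `k
/ 2` such probes. The bad event itself costs `O((k + 1) ^ (-2))` by second moments.

Throughout, `history` contains the entire item process, future included. Events about all later
averages can therefore be conditioned on without disturbing the law of the next probe. -/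

namespace Probing

/-! ### Moments of the item laws -/

namespace IsItemLaw

variable {r : ℝ} {ρ : Measure ℕ}

theorem isProbabilityMeasure (h : IsItemLaw r ρ) : IsProbabilityMeasure ρ := by
  cases h <;> infer_instance

theorem integrable_exp (h : IsItemLaw r ρ) (b : ℝ) :
    Integrable (fun k : ℕ => Real.exp (b * k)) ρ := by
  cases h with
  | bernoulli p => exact integrable_bernoulliMeasure _ _ _ _
  | poisson r =>
    rw [integrable_poissonMeasure_iff]
    refine ((Real.summable_pow_div_factorial ((r : ℝ) * Real.exp b)).mul_left
      (Real.exp (-r))).congr fun k => ?_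
    rw [Real.norm_of_nonneg (Real.exp_pos _).le, mul_pow, ← Real.exp_nat_mul, mul_comm b]
    ring

/-- The Poisson value serves both laws: for Bernoulli, `1 + p * (exp b - 1)` lies below it by `1 + u
≤ exp u`. -/
theorem integral_exp_le (h : IsItemLaw r ρ) (b : ℝ) :
    ∫ k : ℕ, Real.exp (b * k) ∂ρ ≤ Real.exp (r * (Real.exp b - 1)) := by
  cases h with
  | bernoulli p =>
    rw [integral_bernoulliMeasure]
    have := Real.add_one_le_exp ((p : ℝ) * (Real.exp b - 1))
    simp only [Nat.cast_one, mul_one, smul_eq_mul, Nat.cast_zero, mul_zero, Real.exp_zero]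
    linarith
  | poisson r =>
    rw [integral_poissonMeasure]
    have h1 := (NormedSpace.expSeries_div_hasSum_exp ((r : ℝ) * Real.exp b)).mul_left
      (Real.exp (-r))
    rw [← Real.exp_eq_exp_ℝ, ← Real.exp_add] at h1
    have h2 : (fun k : ℕ => (Real.exp (-r) * (r : ℝ) ^ k / (k.factorial : ℝ)) •
        Real.exp (b * k)) =
        fun k : ℕ => Real.exp (-r) * (((r : ℝ) * Real.exp b) ^ k / (k.factorial : ℝ)) := by
      funext k
      rw [mul_pow, ← Real.exp_nat_mul, mul_comm b, smul_eq_mul]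
      ring
    rw [h2, h1.tsum_eq]
    exact le_of_eq (by ring_nf)

theorem integral_cast (h : IsItemLaw r ρ) : ∫ k : ℕ, (k : ℝ) ∂ρ = r := by
  cases h with
  | bernoulli p => simp [integral_bernoulliMeasure]
  | poisson r =>
    rw [integral_poissonMeasure]
    have h1 := (hasSum_one_poissonMeasure r).mul_left (r : ℝ)
    rw [mul_one] at h1
    refine HasSum.tsum_eq ?_
    rw [← hasSum_nat_add_iff' 1]
    have h2 : (fun k : ℕ => (Real.exp (-r) * (r : ℝ) ^ (k + 1) / ((k + 1).factorial : ℝ)) •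
        ((k + 1 : ℕ) : ℝ)) =
        fun k : ℕ => (r : ℝ) * (Real.exp (-r) * (r : ℝ) ^ k / (k.factorial : ℝ)) := by
      funext k
      rw [Nat.factorial_succ, smul_eq_mul]
      push_cast
      have : (k.factorial : ℝ) ≠ 0 := by positivity
      field_simp
      ring
    rw [h2]
    simpa using h1

theorem integrable_pow (h : IsItemLaw r ρ) (m : ℕ) : Integrable (fun k : ℕ => (k : ℝ) ^ m) ρ := by
  have : integrableExpSet (fun k : ℕ => (k : ℝ)) ρ = Set.univ :=
    Set.eq_univ_of_forall fun b => h.integrable_exp b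
  exact integrable_pow_of_mem_interior_integrableExpSet (by simp [this]) m

end IsItemLaw

/-! ### Moments and large deviations of an item process -/

/-- The number of items generated at node `i` in steps `< τ`. -/
def itemSum {n : ℕ} (x : ℕ → Fin n → ℕ) (τ : ℕ) (i : Fin n) : ℕ :=
  ∑ s ∈ Finset.range τ, x s i

namespace IsItemProcess

variable {n : ℕ} {Ω : Type u} [MeasurableSpace Ω] {μ : Measure Ω} {π : Fin n → ℝ}
  {X : ℕ → Fin n → Ω → ℕ}

theorem measurable_cast (hX : IsItemProcess μ π X) (s : ℕ) (i : Fin n) :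
    Measurable fun ω => (X s i ω : ℝ) :=
  measurable_from_nat.comp (hX.measurable s i)

theorem integrable_exp (hX : IsItemProcess μ π X) (b : ℝ) (s : ℕ) (i : Fin n) :
    Integrable (fun ω => Real.exp (b * X s i ω)) μ := by
  obtain ⟨ρ, h, hρ⟩ := hX.law i
  have := h.integrable_exp b
  rw [← hρ s] at this
  exact this.comp_measurable (hX.measurable s i)

theorem mgf_le (hX : IsItemProcess μ π X) (b : ℝ) (s : ℕ) (i : Fin n) :
    mgf (fun ω => (X s i ω : ℝ)) μ b ≤ Real.exp (π i * (Real.exp b - 1)) := by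
  obtain ⟨ρ, h, hρ⟩ := hX.law i
  have := h.integral_exp_le b
  rw [← hρ s, integral_map (hX.measurable s i).aemeasurable
    (measurable_of_countable _).aestronglyMeasurable] at this
  exact this

theorem integrable_pow (hX : IsItemProcess μ π X) (m s : ℕ) (i : Fin n) :
    Integrable (fun ω => (X s i ω : ℝ) ^ m) μ := by
  obtain ⟨ρ, h, hρ⟩ := hX.law i
  have := h.integrable_pow m
  rw [← hρ s] at this
  exact this.comp_measurable (hX.measurable s i)

theorem integrable (hX : IsItemProcess μ π X) (s : ℕ) (i : Fin n) :
    Integrable (fun ω => (X s i ω : ℝ)) μ := by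
  simpa using hX.integrable_pow 1 s i

theorem integral_eq (hX : IsItemProcess μ π X) (s : ℕ) (i : Fin n) :
    ∫ ω, (X s i ω : ℝ) ∂μ = π i := by
  obtain ⟨ρ, h, hρ⟩ := hX.law i
  have := h.integral_cast
  rwa [← hρ s, integral_map (hX.measurable s i).aemeasurable
    (measurable_of_countable _).aestronglyMeasurable] at this

theorem exists_integral_sq_eq (hX : IsItemProcess μ π X) (i : Fin n) :
    ∃ V : ℝ, 0 ≤ V ∧ ∀ s, ∫ ω, (X s i ω : ℝ) ^ 2 ∂μ = V := by
  obtain ⟨ρ, h, hρ⟩ := hX.law i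
  refine ⟨∫ k : ℕ, (k : ℝ) ^ 2 ∂ρ, integral_nonneg fun _ => by positivity, fun s => ?_⟩
  rw [← hρ s, integral_map (hX.measurable s i).aemeasurable
    (measurable_of_countable _).aestronglyMeasurable]

theorem iIndepFun_node (hX : IsItemProcess μ π X) (i : Fin n) :
    iIndepFun (fun s ω => (X s i ω : ℝ)) μ := by
  have h1 : iIndepFun (fun s => X s i) μ :=
    hX.indep.precomp (g := fun s : ℕ => (s, i)) fun a b h => (Prod.mk.inj h).1
  exact h1.comp (fun _ k => (k : ℝ)) fun _ => measurable_from_nat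

theorem ae_tendsto_average (hX : IsItemProcess μ π X) (i : Fin n) :
    ∀ᵐ ω ∂μ, Tendsto (fun τ : ℕ => (itemSum (fun s j => X s j ω) τ i : ℝ) / τ) atTop
      (𝓝 (π i)) := by
  obtain ⟨ρ, -, hρ⟩ := hX.law i
  have := strong_law_ae_real (fun s ω => (X s i ω : ℝ)) (hX.integrable 0 i)
    (fun s t hst => (hX.iIndepFun_node i).indepFun hst)
    (fun s => (IdentDistrib.comp (⟨(hX.measurable s i).aemeasurable,
      (hX.measurable 0 i).aemeasurable, by rw [hρ, hρ]⟩ : IdentDistrib (X s i) (X 0 i) μ μ)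
      (u := fun k : ℕ => (k : ℝ)) measurable_from_nat))
  simpa [itemSum, hX.integral_eq] using this

theorem integrable_exp_itemSum (hX : IsItemProcess μ π X) (b : ℝ) (τ : ℕ) (i : Fin n) :
    Integrable (fun ω => Real.exp (b * (∑ s ∈ Finset.range τ, fun ω => (X s i ω : ℝ)) ω)) μ :=
  have := hX.indep.isProbabilityMeasure
  (hX.iIndepFun_node i).integrable_exp_mul_sum (fun s => hX.measurable_cast s i)
    fun s _ => hX.integrable_exp b s i

theorem mgf_itemSum_le (hX : IsItemProcess μ π X) (b : ℝ) (τ : ℕ) (i : Fin n) :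
    mgf (∑ s ∈ Finset.range τ, fun ω => (X s i ω : ℝ)) μ b ≤
      Real.exp (τ * (π i * (Real.exp b - 1))) := by
  rw [(hX.iIndepFun_node i).mgf_sum fun s => hX.measurable_cast s i]
  calc _ ≤ ∏ _s ∈ Finset.range τ, Real.exp (π i * (Real.exp b - 1)) :=
        Finset.prod_le_prod (fun _ _ => mgf_nonneg) fun s _ => hX.mgf_le b s i
    _ = _ := by rw [Finset.prod_const, Finset.card_range, ← Real.exp_nat_mul]

/-- Chernoff bound with parameter `1`; the factor `2` comes from `exp 1 - 1 ≤ 2`. -/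
theorem measureReal_le_itemSum (hX : IsItemProcess μ π X) (hπ : ∀ i, 0 ≤ π i) (K : ℝ) (τ : ℕ)
    (i : Fin n) : μ.real {ω | τ * K ≤ (itemSum (fun s j => X s j ω) τ i : ℝ)} ≤
      Real.exp (-(K - 2 * π i)) ^ τ := by
  have := hX.indep.isProbabilityMeasure
  have h := measure_ge_le_exp_mul_mgf (μ := μ) (τ * K) zero_le_one
    (hX.integrable_exp_itemSum 1 τ i)
  simp only [Finset.sum_apply] at h
  simp only [itemSum, Nat.cast_sum]
  refine h.trans ((mul_le_mul_of_nonneg_left (hX.mgf_itemSum_le 1 τ i)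
    (Real.exp_pos _).le).trans ?_)
  rw [← Real.exp_add, ← Real.exp_nat_mul, Real.exp_le_exp]
  have h1 : π i * (Real.exp 1 - 1) ≤ π i * 2 :=
    mul_le_mul_of_nonneg_left (by linarith [Real.exp_one_lt_d9]) (hπ i)
  nlinarith [mul_le_mul_of_nonneg_left h1 (Nat.cast_nonneg (α := ℝ) τ)]

/-- Chernoff bound with parameter `-1`. It decays when `0 < π i`, since `exp (-1) < 1 / 2`. -/
theorem measureReal_itemSum_le (hX : IsItemProcess μ π X) (τ : ℕ)
    (i : Fin n) : μ.real {ω | (itemSum (fun s j => X s j ω) τ i : ℝ) ≤ τ * (π i / 2)} ≤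
      Real.exp (-(π i * (1 / 2 - Real.exp (-1)))) ^ τ := by
  have := hX.indep.isProbabilityMeasure
  have h := measure_le_le_exp_mul_mgf (μ := μ) (τ * (π i / 2)) (by norm_num : (-1 : ℝ) ≤ 0)
    (hX.integrable_exp_itemSum (-1) τ i)
  simp only [Finset.sum_apply] at h
  simp only [itemSum, Nat.cast_sum]
  refine h.trans ((mul_le_mul_of_nonneg_left (hX.mgf_itemSum_le (-1) τ i)
    (Real.exp_pos _).le).trans ?_)
  rw [← Real.exp_add, ← Real.exp_nat_mul, Real.exp_le_exp]
  exact le_of_eq (by ring)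

end IsItemProcess

/-- A union bound for events with geometrically small probabilities. -/
theorem measureReal_iUnion_le_of_le_pow {Ω : Type u} [MeasurableSpace Ω] {μ : Measure Ω}
    {B : ℕ → Set Ω} {q : ℝ} (hq : 0 ≤ q) (hq1 : q < 1) (h : ∀ τ, μ.real (B τ) ≤ q ^ τ)
    [IsFiniteMeasure μ] (τ₀ : ℕ) :
    μ.real {ω | ∃ τ, τ₀ ≤ τ ∧ ω ∈ B τ} ≤ q ^ τ₀ / (1 - q) := by
  have hs : HasSum (fun m => q ^ τ₀ * q ^ m) (q ^ τ₀ / (1 - q)) := by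
    rw [div_eq_mul_inv]
    exact (hasSum_geometric_of_lt_one hq hq1).mul_left _
  have h0 : 0 ≤ q ^ τ₀ / (1 - q) := div_nonneg (pow_nonneg hq _) (by linarith)
  refine ENNReal.toReal_le_of_le_ofReal h0 ?_
  have hsub : {ω | ∃ τ, τ₀ ≤ τ ∧ ω ∈ B τ} ⊆ ⋃ m, B (τ₀ + m) := by
    rintro ω ⟨τ, hτ, hω⟩
    exact Set.mem_iUnion.2 ⟨τ - τ₀, by rwa [Nat.add_sub_cancel' hτ]⟩
  refine (measure_mono hsub).trans ((measure_iUnion_le _).trans ?_)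
  rw [← hs.tsum_eq, ENNReal.ofReal_tsum_of_nonneg (fun m => by positivity) hs.summable]
  refine ENNReal.tsum_le_tsum fun m => ?_
  rw [← ENNReal.ofReal_toReal (measure_ne_top μ (B (τ₀ + m))), ← pow_add]
  exact ENNReal.ofReal_le_ofReal (h _)

/-! ### Pathwise analysis of Adaptive -/

section Pathwise

variable {n : ℕ} (x : ℕ → Fin n → ℕ) (a : ℕ → Fin n)

/-- The estimate that Adaptive forms for node `i` when it probes it at time `τ`. -/
noncomputable def empirical (τ : ℕ) (i : Fin n) : ℝ :=
  max 1 (itemSum x τ i : ℝ) / τ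

theorem undiscovered_succ_of_eq {t : ℕ} {i : Fin n} (h : a t = i) :
    undiscovered x a (t + 1) i = x t i := by
  rw [undiscovered, Finset.sum_range_succ, Finset.sum_eq_zero, zero_add, if_neg]
  · rintro ⟨r, hr, -⟩
    rw [Finset.mem_Ioo] at hr
    omega
  · intro s hs
    exact if_pos ⟨t, by simpa using hs, h⟩

theorem undiscovered_succ_of_ne {t : ℕ} {i : Fin n} (h : a t ≠ i) :
    undiscovered x a (t + 1) i = undiscovered x a t i + x t i := by
  rw [undiscovered, Finset.sum_range_succ, if_neg]
  · congr 1
    refine Finset.sum_congr rfl fun s _ => ?_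
    congr 1
    refine propext ⟨?_, ?_⟩
    · rintro ⟨r, hr, hri⟩
      rw [Finset.mem_Ioo] at hr
      refine ⟨r, Finset.mem_Ioo.2 ⟨hr.1, lt_of_le_of_ne (Nat.lt_succ_iff.1 hr.2) ?_⟩, hri⟩
      rintro rfl
      exact h hri
    · rintro ⟨r, hr, hri⟩
      rw [Finset.mem_Ioo] at hr
      exact ⟨r, Finset.mem_Ioo.2 ⟨hr.1, by omega⟩, hri⟩
  · rintro ⟨r, hr, -⟩
    rw [Finset.mem_Ioo] at hr
    omega

/-- Conservation of items. A probe moves all pending items of its node into the counter, so at a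
probe the counter equals the full item count and the estimate no longer depends on earlier probes.
-/
theorem caught_add_undiscovered (t : ℕ) (i : Fin n) :
    caught x a t i + undiscovered x a (t + 1) i = itemSum x (t + 1) i := by
  induction t with
  | zero => simp [caught, undiscovered, itemSum]
  | succ t ih =>
    rw [itemSum, Finset.sum_range_succ, ← itemSum, ← ih, caught]
    by_cases h : a (t + 1) = i
    · rw [undiscovered_succ_of_eq x a h, h, Function.update_self]
    · rw [undiscovered_succ_of_ne x a h, Function.update_of_ne (Ne.symm h), add_assoc]

theorem estimate_succ_of_eq {t : ℕ} {i : Fin n} (h : a (t + 1) = i) :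
    estimate x a (t + 1) i = empirical x (t + 1) i := by
  subst h
  rw [estimate, Function.update_self, caught, Function.update_self, caught_add_undiscovered,
    empirical]
  push_cast
  rfl

theorem estimate_succ_of_ne {t : ℕ} {i : Fin n} (h : a (t + 1) ≠ i) :
    estimate x a (t + 1) i = estimate x a t i := by
  rw [estimate, Function.update_of_ne (Ne.symm h)]

theorem estimate_eq_empirical {lo t r : ℕ} {i : Fin n} (hr : r ∈ Finset.Ioc lo t) (h : a r = i) :
    ∃ τ ∈ Finset.Ioc lo t, estimate x a t i = empirical x τ i := by
  induction t with
  | zero => simp at hr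
  | succ t ih =>
    rw [Finset.mem_Ioc] at hr
    by_cases h1 : a (t + 1) = i
    · exact ⟨t + 1, Finset.mem_Ioc.2 ⟨by omega, le_rfl⟩, estimate_succ_of_eq x a h1⟩
    · have hne : r ≠ t + 1 := by
        rintro rfl
        exact h1 h
      obtain ⟨τ, hτ, he⟩ := ih (Finset.mem_Ioc.2 ⟨hr.1, by omega⟩)
      rw [Finset.mem_Ioc] at hτ
      exact ⟨τ, Finset.mem_Ioc.2 ⟨hτ.1, by omega⟩, by rw [estimate_succ_of_ne x a h1, he]⟩

theorem estimate_eq_one_or (t : ℕ) (i : Fin n) :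
    estimate x a t i = 1 ∨ ∃ τ ∈ Finset.Ioc 0 t, estimate x a t i = empirical x τ i := by
  by_cases h : ∃ r ∈ Finset.Ioc 0 t, a r = i
  · obtain ⟨r, hr, h⟩ := h
    exact Or.inr (estimate_eq_empirical x a hr h)
  · left
    induction t with
    | zero => rfl
    | succ t ih =>
      push Not at h
      rw [estimate_succ_of_ne x a (h _ (by simp))]
      refine ih ?_
      rintro ⟨r, hr, h1⟩
      rw [Finset.mem_Ioc] at hr
      exact h r (Finset.mem_Ioc.2 ⟨hr.1, by omega⟩) h1

theorem empirical_pos {τ : ℕ} (hτ : 0 < τ) (i : Fin n) : 0 < empirical x τ i :=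
  div_pos (lt_of_lt_of_le one_pos (le_max_left _ _)) (by exact_mod_cast hτ)

theorem estimate_pos (t : ℕ) (i : Fin n) : 0 < estimate x a t i := by
  rcases estimate_eq_one_or x a t i with h | ⟨τ, hτ, h⟩
  · rw [h]
    exact one_pos
  · rw [h]
    exact empirical_pos x (Finset.mem_Ioc.1 hτ).1 i

/-- This is what the `max 1` in the algorithm buys: no node is ever starved faster than at rate `1 /
t`, even one that generates nothing. -/
theorem one_le_mul_estimate {t : ℕ} (ht : 1 ≤ t) (i : Fin n) : 1 ≤ t * estimate x a t i := by
  have ht' : (1 : ℝ) ≤ t := by exact_mod_cast ht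
  rcases estimate_eq_one_or x a t i with h | ⟨τ, hτ, h⟩
  · rwa [h, mul_one]
  · rw [Finset.mem_Ioc] at hτ
    have h0 : (0 : ℝ) < τ := by exact_mod_cast hτ.1
    have h1 : (τ : ℝ) ≤ t := by exact_mod_cast hτ.2
    rw [h, empirical, mul_div_assoc', le_div_iff₀ h0, one_mul]
    nlinarith [le_max_left (1 : ℝ) (itemSum x τ i : ℝ)]

theorem empirical_le {τ : ℕ} {i : Fin n} {M : ℝ} (hM : 1 ≤ M) (hτ : 0 < τ)
    (h : (itemSum x τ i : ℝ) ≤ τ * M) : empirical x τ i ≤ M := by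
  have h1 : (1 : ℝ) ≤ τ := by exact_mod_cast hτ
  rw [empirical, div_le_iff₀ (by linarith), max_le_iff]
  constructor <;> nlinarith

theorem le_empirical {τ : ℕ} {i : Fin n} {m : ℝ} (hτ : 0 < τ)
    (h : τ * m ≤ (itemSum x τ i : ℝ)) : m ≤ empirical x τ i := by
  have h1 : (0 : ℝ) < τ := by exact_mod_cast hτ
  rw [empirical, le_div_iff₀ h1]
  linarith [le_max_right (1 : ℝ) (itemSum x τ i : ℝ)]

theorem estimate_le {t : ℕ} {i : Fin n} {M : ℝ} (hM : 1 ≤ M)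
    (h : ∀ τ, 1 ≤ τ → (itemSum x τ i : ℝ) ≤ τ * M) : estimate x a t i ≤ M := by
  rcases estimate_eq_one_or x a t i with h1 | ⟨τ, hτ, h1⟩
  · rwa [h1]
  · rw [Finset.mem_Ioc] at hτ
    rw [h1]
    exact empirical_le x hM hτ.1 (h τ hτ.1)

theorem tendsto_empirical {i : Fin n} {c : ℝ} (hc : 0 ≤ c)
    (h : Tendsto (fun τ : ℕ => (itemSum x τ i : ℝ) / τ) atTop (𝓝 c)) :
    Tendsto (fun τ => empirical x τ i) atTop (𝓝 c) := by
  have h1 := tendsto_one_div_atTop_nhds_zero_nat (𝕜 := ℝ).max h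
  rw [max_eq_right hc] at h1
  refine h1.congr fun τ => ?_
  rw [empirical, max_div_div_right (Nat.cast_nonneg τ)]

theorem tendsto_estimate {i : Fin n} {c : ℝ} (hc : 0 ≤ c)
    (h : Tendsto (fun τ : ℕ => (itemSum x τ i : ℝ) / τ) atTop (𝓝 c))
    (hp : ∀ lo, ∃ r, lo < r ∧ a r = i) :
    Tendsto (fun t => estimate x a t i) atTop (𝓝 c) := by
  have h1 := tendsto_empirical x hc h
  rw [tendsto_atTop'] at h1 ⊢
  intro s hs
  obtain ⟨lo, hlo⟩ := h1 s hs
  obtain ⟨r, hr, hri⟩ := hp lo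
  refine ⟨r, fun t ht => ?_⟩
  obtain ⟨τ, hτ, he⟩ := estimate_eq_empirical x a (Finset.mem_Ioc.2 ⟨hr, ht⟩) hri
  rw [he]
  exact hlo τ (Finset.mem_Ioc.1 hτ).1.le

end Pathwise

/-! ### Probabilities proportional to square roots -/

section SqrtProbs

variable {n : ℕ} {f : Fin n → ℝ}

theorem sqrtProbs_nonneg (f : Fin n → ℝ) (i : Fin n) : 0 ≤ sqrtProbs f i :=
  div_nonneg (Real.sqrt_nonneg _) (Finset.sum_nonneg fun _ _ => Real.sqrt_nonneg _)

theorem sqrtProbs_le_one (f : Fin n → ℝ) (i : Fin n) : sqrtProbs f i ≤ 1 :=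
  div_le_one_of_le₀ (Finset.single_le_sum (fun _ _ => Real.sqrt_nonneg _) (Finset.mem_univ i))
    (Finset.sum_nonneg fun _ _ => Real.sqrt_nonneg _)

theorem le_sqrtProbs {m M : ℝ} {i : Fin n} (hm : 0 < m) (hi : m ≤ f i) (hM : ∀ j, f j ≤ M) :
    √m / (n * √M) ≤ sqrtProbs f i := by
  have h1 : ∑ j, √(f j) ≤ n * √M := by
    refine (Finset.sum_le_sum fun j _ => Real.sqrt_le_sqrt (hM j)).trans (le_of_eq ?_)
    simp
  have h2 : 0 < √(f i) := Real.sqrt_pos.2 (hm.trans_le hi)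
  have h3 : √(f i) ≤ ∑ j, √(f j) :=
    Finset.single_le_sum (fun _ _ => Real.sqrt_nonneg _) (Finset.mem_univ i)
  exact div_le_div₀ h2.le (Real.sqrt_le_sqrt hi) (h2.trans_le h3) h1

theorem tendsto_sqrtProbs {ι : Type*} {l : Filter ι} {g : ι → Fin n → ℝ} (hf : 0 < ∑ j, √(f j))
    (h : ∀ j, Tendsto (fun t => g t j) l (𝓝 (f j))) (i : Fin n) :
    Tendsto (fun t => sqrtProbs (g t) i) l (𝓝 (sqrtProbs f i)) :=
  (h i).sqrt.div (tendsto_finsetSum _ fun j _ => (h j).sqrt) hf.ne'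

end SqrtProbs

/-! ### Schedules driven by a rule -/

section NoProbe

variable {n : ℕ} {Ω : Type u}

/-- The event that node `i` is not probed at the times in `(a, b]`. -/
def noProbe (S : ℕ → Ω → Fin n) (i : Fin n) (a b : ℕ) : Set Ω :=
  {ω | ∀ r ∈ Finset.Ioc a b, S r ω ≠ i}

theorem noProbe_self (S : ℕ → Ω → Fin n) (i : Fin n) (a : ℕ) :
    noProbe S i a a = Set.univ := by
  simp [noProbe]

theorem noProbe_succ (S : ℕ → Ω → Fin n) (i : Fin n) {a b : ℕ} (h : a ≤ b) :
    noProbe S i a (b + 1) = noProbe S i a b \ S (b + 1) ⁻¹' {i} := by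
  ext ω
  simp only [noProbe, Set.mem_ofPred_eq, Set.mem_sdiff, Set.mem_preimage, Set.mem_singleton_iff,
    Finset.mem_Ioc]
  constructor
  · exact fun H => ⟨fun r hr => H r ⟨hr.1, by omega⟩, H _ ⟨by omega, le_rfl⟩⟩
  · rintro ⟨H1, H2⟩ r ⟨hr1, hr2⟩
    rcases Nat.lt_or_ge b r with h3 | h3
    · rwa [show r = b + 1 by omega]
    · exact H1 r ⟨hr1, h3⟩

theorem noProbe_mono (S : ℕ → Ω → Fin n) (i : Fin n) {a a' b b' : ℕ} (ha : a ≤ a')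
    (hb : b' ≤ b) : noProbe S i a b ⊆ noProbe S i a' b' := by
  intro ω h r hr
  rw [Finset.mem_Ioc] at hr
  exact h r (Finset.mem_Ioc.2 ⟨by omega, by omega⟩)

theorem cast_undiscovered (X : ℕ → Fin n → Ω → ℕ) (S : ℕ → Ω → Fin n) (t : ℕ) (i : Fin n) (ω : Ω) :
    (undiscovered (fun s j => X s j ω) (fun r => S r ω) t i : ℝ) =
      ∑ s ∈ Finset.range t, (noProbe S i s (t - 1)).indicator (fun ω => (X s i ω : ℝ)) ω := by
  rw [undiscovered, Nat.cast_sum]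
  refine Finset.sum_congr rfl fun s hs => ?_
  have h : (∃ r ∈ Finset.Ioo s t, S r ω = i) ↔ ω ∉ noProbe S i s (t - 1) := by
    simp only [noProbe, Set.mem_ofPred_eq]
    push Not
    have : Finset.Ioo s t = Finset.Ioc s (t - 1) := by
      ext r
      simp only [Finset.mem_Ioo, Finset.mem_Ioc]
      omega
    rw [this]
  by_cases h1 : ω ∈ noProbe S i s (t - 1)
  · rw [Set.indicator_of_mem h1, if_neg (by rw [h]; exact not_not.2 h1)]
  · rw [Set.indicator_of_notMem h1, if_pos (h.2 h1), Nat.cast_zero]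

theorem measurable_history_item {X : ℕ → Fin n → Ω → ℕ} {S : ℕ → Ω → Fin n} (s : ℕ) (i : Fin n)
    (t : ℕ) :
    Measurable[history X S t] (X s i) :=
  measurable_iff_comap_le.2 <|
    (le_iSup₂ (f := fun s i => MeasurableSpace.comap (X s i) inferInstance) s i).trans le_sup_left

theorem measurable_history_probe {X : ℕ → Fin n → Ω → ℕ} {S : ℕ → Ω → Fin n} {r t : ℕ}
    (h1 : 1 ≤ r) (h2 : r ≤ t) :
    Measurable[history X S t] (S r) :=
  measurable_iff_comap_le.2 <|
    (le_iSup₂ (f := fun r (_ : r ∈ Finset.Icc 1 t) => MeasurableSpace.comap (S r) inferInstance)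
      r (Finset.mem_Icc.2 ⟨h1, h2⟩)).trans le_sup_right

theorem measurableSet_history_noProbe (X : ℕ → Fin n → Ω → ℕ) {S : ℕ → Ω → Fin n}
    (i : Fin n) {a b t : ℕ}
    (h : b ≤ t) : MeasurableSet[history X S t] (noProbe S i a b) := by
  have : noProbe S i a b = ⋂ r ∈ Finset.Ioc a b, (S r ⁻¹' {i})ᶜ := by
    ext ω
    simp [noProbe]
  rw [this]
  refine Finset.measurableSet_biInter _ fun r hr => ?_
  rw [Finset.mem_Ioc] at hr
  exact (measurable_history_probe (X := X) (by omega) (hr.2.trans h)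
    (measurableSet_singleton i)).compl

/-- The conditional probability that the probe at time `t + 1` is at node `i`. -/
def probeProb (rule : (ℕ → Fin n → ℕ) → (ℕ → Fin n) → ℕ → Fin n → ℝ)
    (X : ℕ → Fin n → Ω → ℕ) (S : ℕ → Ω → Fin n) (i : Fin n) (t : ℕ) (ω : Ω) : ℝ :=
  rule (fun s j => X s j ω) (fun r => S r ω) t i

end NoProbe

section Driven

variable {n : ℕ} {Ω : Type u} [mΩ : MeasurableSpace Ω] {μ : Measure Ω}
  {rule : (ℕ → Fin n → ℕ) → (ℕ → Fin n) → ℕ → Fin n → ℝ}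
  {X : ℕ → Fin n → Ω → ℕ} {S : ℕ → Ω → Fin n}

theorem history_le (hX : ∀ s i, Measurable (X s i)) (hS : ∀ t, Measurable (S t)) (t : ℕ) :
    history X S t ≤ mΩ :=
  sup_le (iSup_le fun s => iSup_le fun i => (hX s i).comap_le)
    (iSup_le fun r => iSup_le fun _ => (hS r).comap_le)

theorem measurableSet_noProbe (hS : ∀ t, Measurable (S t)) (i : Fin n) (a b : ℕ) :
    MeasurableSet (noProbe S i a b) := by
  have : noProbe S i a b = ⋂ r ∈ Finset.Ioc a b, (S r ⁻¹' {i})ᶜ := by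
    ext ω
    simp [noProbe]
  rw [this]
  exact Finset.measurableSet_biInter _ fun r _ => (hS r (measurableSet_singleton i)).compl

namespace IsDrivenBy

theorem aestronglyMeasurable_probeProb (hS : IsDrivenBy μ rule X S)
    (hX : ∀ s i, Measurable (X s i)) (i : Fin n) (t : ℕ) :
    AEStronglyMeasurable (probeProb rule X S i t) μ :=
  (stronglyMeasurable_condExp.mono (history_le hX hS.measurable t)).aestronglyMeasurable.congr
    (hS.condProb t i)

variable [IsProbabilityMeasure μ]

theorem condExp_mul_indicator_probe (hS : IsDrivenBy μ rule X S)
    {Z : Ω → ℝ} {t : ℕ} (hZ : StronglyMeasurable[history X S t] Z) (hZi : Integrable Z μ)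
    (i : Fin n) :
    μ[Z * (S (t + 1) ⁻¹' {i}).indicator (fun _ => 1) | history X S t] =ᵐ[μ]
      Z * probeProb rule X S i t := by
  have hm := hS.measurable (t + 1) (measurableSet_singleton i)
  refine (condExp_mul_of_stronglyMeasurable_left hZ ?_ ?_).trans ?_
  · have : Z * (S (t + 1) ⁻¹' {i}).indicator (fun _ => (1 : ℝ)) =
        (S (t + 1) ⁻¹' {i}).indicator Z := by
      ext ω
      by_cases h : ω ∈ S (t + 1) ⁻¹' {i} <;> simp [Set.indicator, h]
    rw [this]
    exact hZi.indicator hm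
  · exact (integrable_const _).indicator hm
  · filter_upwards [hS.condProb t i] with ω hω
    simp only [Pi.mul_apply]
    rw [hω]
    rfl

theorem integrable_mul_probeProb (hS : IsDrivenBy μ rule X S)
    {Z : Ω → ℝ} {t : ℕ} (hZ : StronglyMeasurable[history X S t] Z) (hZi : Integrable Z μ)
    (i : Fin n) : Integrable (fun ω => Z ω * probeProb rule X S i t ω) μ :=
  integrable_condExp.congr (hS.condExp_mul_indicator_probe hZ hZi i)

theorem setIntegral_probe (hS : IsDrivenBy μ rule X S) (hX : ∀ s i, Measurable (X s i))
    {Z : Ω → ℝ} {t : ℕ} (hZ : StronglyMeasurable[history X S t] Z) (hZi : Integrable Z μ)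
    (i : Fin n) : ∫ ω in S (t + 1) ⁻¹' {i}, Z ω ∂μ = ∫ ω, Z ω * probeProb rule X S i t ω ∂μ := by
  have hm := hS.measurable (t + 1) (measurableSet_singleton i)
  have h := integral_congr_ae (hS.condExp_mul_indicator_probe hZ hZi i)
  rw [integral_condExp (history_le hX hS.measurable t)] at h
  rw [← integral_indicator hm]
  refine Eq.trans (integral_congr_ae (Eventually.of_forall fun ω => ?_)) h
  by_cases h : ω ∈ S (t + 1) ⁻¹' {i} <;> simp [Set.indicator, h]

/-- The basic recursion: `Z` and the event of no probe so far are known to the history, so the mass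
lost at the next probe is its conditional probability integrated against them. -/
theorem setIntegral_noProbe_succ (hS : IsDrivenBy μ rule X S) (hX : ∀ s i, Measurable (X s i))
    {Z : Ω → ℝ} {a : ℕ} (hZ : ∀ t, a ≤ t → StronglyMeasurable[history X S t] Z)
    (hZi : Integrable Z μ) (i : Fin n) (m : ℕ) :
    ∫ ω in noProbe S i a (a + (m + 1)), Z ω ∂μ =
      ∫ ω in noProbe S i a (a + m), Z ω ∂μ -
        ∫ ω in noProbe S i a (a + m), Z ω * probeProb rule X S i (a + m) ω ∂μ := by
  have hN := measurableSet_noProbe hS.measurable i a (a + m)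
  have hm := hS.measurable (a + m + 1) (measurableSet_singleton i)
  have h1 := hS.setIntegral_probe hX
    ((hZ (a + m) (Nat.le_add_right a m)).indicator
      (measurableSet_history_noProbe X i (a := a) le_rfl)) (hZi.indicator hN) i
  have h2 : ∀ ω, (noProbe S i a (a + m)).indicator Z ω * probeProb rule X S i (a + m) ω =
      (noProbe S i a (a + m)).indicator (fun ω => Z ω * probeProb rule X S i (a + m) ω) ω :=
    fun ω => (Set.indicator_mul_left _ _ _).symm
  simp_rw [h2] at h1
  rw [setIntegral_indicator hN, Set.inter_comm, integral_indicator hN] at h1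
  rw [← h1, ← add_assoc, noProbe_succ S i (Nat.le_add_right a m), eq_sub_iff_add_eq, add_comm]
  exact integral_inter_add_sdiff hm hZi.integrableOn

/-- Each probe removes at least a fraction `δ` of the remaining mass. Requiring the bound only where
`Z ω ≠ 0` lets `Z` carry the indicator of a good event. -/
theorem setIntegral_noProbe_le (hS : IsDrivenBy μ rule X S) (hX : ∀ s i, Measurable (X s i))
    {Z : Ω → ℝ} {a : ℕ} (hZ : ∀ t, a ≤ t → StronglyMeasurable[history X S t] Z)
    (hZi : Integrable Z μ) (hZ0 : ∀ ω, 0 ≤ Z ω) {i : Fin n} {m : ℕ} {δ : ℝ} (hδ : δ ≤ 1)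
    (h : ∀ r, a ≤ r → r < a + m → ∀ ω, Z ω ≠ 0 → δ ≤ probeProb rule X S i r ω) :
    ∫ ω in noProbe S i a (a + m), Z ω ∂μ ≤ (1 - δ) ^ m * ∫ ω, Z ω ∂μ := by
  induction m with
  | zero => simp [noProbe_self]
  | succ m ih =>
    have ih := ih fun r h1 h2 => h r h1 (by omega)
    have h1 : δ * ∫ ω in noProbe S i a (a + m), Z ω ∂μ ≤
        ∫ ω in noProbe S i a (a + m), Z ω * probeProb rule X S i (a + m) ω ∂μ := by
      rw [← integral_const_mul]
      refine integral_mono (hZi.integrableOn.const_mul δ)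
        (hS.integrable_mul_probeProb (hZ _ (Nat.le_add_right a m)) hZi i).integrableOn
        fun ω => ?_
      by_cases hω : Z ω = 0
      · simp [hω]
      · rw [mul_comm]
        exact mul_le_mul_of_nonneg_left
          (h (a + m) (Nat.le_add_right a m) (by omega) ω hω) (hZ0 ω)
    rw [hS.setIntegral_noProbe_succ hX hZ hZi, pow_succ]
    nlinarith [mul_le_mul_of_nonneg_left ih (sub_nonneg.2 hδ)]

/-- The recursion with `c` in place of the true probe probability has error at most `∫ Z *
|probeProb - c|` per step, and only the fixed number `m` of steps occurs. -/
theorem tendsto_setIntegral_noProbe (hS : IsDrivenBy μ rule X S)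
    (hX : ∀ s i, Measurable (X s i)) {Z : ℕ → Ω → ℝ}
    (hZ : ∀ a t, StronglyMeasurable[history X S t] (Z a))
    (hZi : ∀ a, Integrable (Z a) μ) (hZ0 : ∀ a ω, 0 ≤ Z a ω) {i : Fin n} {z c : ℝ}
    (hz : ∀ a, ∫ ω, Z a ω ∂μ = z)
    (h : ∀ m, Tendsto (fun a => ∫ ω, Z a ω * |probeProb rule X S i (a + m) ω - c| ∂μ) atTop
      (𝓝 0)) (m : ℕ) :
    Tendsto (fun a => ∫ ω in noProbe S i a (a + m), Z a ω ∂μ) atTop (𝓝 ((1 - c) ^ m * z)) := by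
  induction m with
  | zero => simp [noProbe_self, hz]
  | succ m ih =>
    have hi : ∀ a, Integrable (fun ω => Z a ω * (probeProb rule X S i (a + m) ω - c)) μ := by
      intro a
      simp_rw [mul_sub]
      exact (hS.integrable_mul_probeProb (hZ a (a + m)) (hZi a) i).sub ((hZi a).mul_const c)
    have h1 : Tendsto (fun a => ∫ ω in noProbe S i a (a + m),
        Z a ω * (probeProb rule X S i (a + m) ω - c) ∂μ) atTop (𝓝 0) := by
      refine squeeze_zero_norm (fun a => ?_) (h m)
      refine (norm_integral_le_integral_norm _).trans
        ((setIntegral_le_integral (hi a).norm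
          (Eventually.of_forall fun ω => norm_nonneg _)).trans
          (le_of_eq (integral_congr_ae (Eventually.of_forall fun ω => ?_))))
      simp only [norm_mul, Real.norm_eq_abs, abs_of_nonneg (hZ0 a ω)]
    have h2 := (ih.const_mul (1 - c)).sub h1
    rw [sub_zero, ← mul_assoc, ← pow_succ'] at h2
    refine h2.congr fun a => ?_
    rw [hS.setIntegral_noProbe_succ hX (fun t _ => hZ a t) (hZi a)]
    simp_rw [mul_sub]
    rw [integral_sub
      (hS.integrable_mul_probeProb (hZ a (a + m)) (hZi a) i).integrableOn
      ((hZi a).mul_const c).integrableOn, integral_mul_const]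
    ring

theorem setIntegral_noProbe_eq (hS : IsDrivenBy μ rule X S)
    (hX : ∀ s i, Measurable (X s i)) {Z : Ω → ℝ} {a : ℕ}
    (hZ : ∀ t, a ≤ t → StronglyMeasurable[history X S t] Z) (hZi : Integrable Z μ) {i : Fin n}
    {c : ℝ} (h : ∀ r ω, probeProb rule X S i r ω = c) (m : ℕ) :
    ∫ ω in noProbe S i a (a + m), Z ω ∂μ = (1 - c) ^ m * ∫ ω, Z ω ∂μ := by
  induction m with
  | zero => simp [noProbe_self]
  | succ m ih =>
    rw [hS.setIntegral_noProbe_succ hX hZ hZi]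
    simp_rw [h]
    rw [integral_mul_const, ih]
    ring

end IsDrivenBy

/-! ### The expected number of undiscovered items as a sum -/

/-- The expected number of undiscovered items at node `i` and time `t`, as a sum over the age `k`
of the items. -/
noncomputable def meanUndiscovered (μ : Measure Ω) (X : ℕ → Fin n → Ω → ℕ) (S : ℕ → Ω → Fin n)
    (t : ℕ) (i : Fin n) : ℝ :=
  ∑ k ∈ Finset.range t,
    ∫ ω in noProbe S i (t - 1 - k) (t - 1 - k + k), (X (t - 1 - k) i ω : ℝ) ∂μ

theorem meanUndiscovered_nonneg (μ : Measure Ω) (X : ℕ → Fin n → Ω → ℕ) (S : ℕ → Ω → Fin n)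
    (t : ℕ) (i : Fin n) : 0 ≤ meanUndiscovered μ X S t i :=
  Finset.sum_nonneg fun _ _ => integral_nonneg fun _ => Nat.cast_nonneg _

/-- The sum over generation steps is reflected to run over ages, because it is at fixed age that the
terms have a limit. -/
theorem IsItemProcess.expectedUndiscovered_eq {π : Fin n → ℝ} (hX : IsItemProcess μ π X)
    (hS : ∀ t, Measurable (S t)) (t : ℕ) :
    expectedUndiscovered μ X S t = ENNReal.ofReal (∑ i, meanUndiscovered μ X S t i) := by
  have hi : ∀ i s, Integrable
      ((noProbe S i s (t - 1)).indicator (fun ω => (X s i ω : ℝ))) μ := fun i s =>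
    (hX.integrable s i).indicator (measurableSet_noProbe hS i s (t - 1))
  have h1 : ∀ ω, (totalUndiscovered (fun s j => X s j ω) (fun r => S r ω) t : ℝ≥0∞) =
      ENNReal.ofReal (∑ i, ∑ s ∈ Finset.range t,
        (noProbe S i s (t - 1)).indicator (fun ω => (X s i ω : ℝ)) ω) := by
    intro ω
    rw [← ENNReal.ofReal_natCast, totalUndiscovered, Nat.cast_sum]
    simp_rw [cast_undiscovered]
  rw [expectedUndiscovered]
  simp_rw [h1]
  rw [← ofReal_integral_eq_lintegral_ofReal
    (integrable_finsetSum _ fun i _ => integrable_finsetSum _ fun s _ => hi i s)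
    (Eventually.of_forall fun ω => Finset.sum_nonneg fun i _ => Finset.sum_nonneg fun s _ =>
      Set.indicator_nonneg (fun _ _ => Nat.cast_nonneg _) _),
    integral_finsetSum _ fun i _ => integrable_finsetSum _ fun s _ => hi i s]
  congr 1
  refine Finset.sum_congr rfl fun i _ => ?_
  rw [integral_finsetSum _ fun s _ => hi i s, ← Finset.sum_range_reflect]
  refine Finset.sum_congr rfl fun k hk => ?_
  rw [Finset.mem_range] at hk
  rw [integral_indicator (measurableSet_noProbe hS _ _ _),
    show t - 1 - k + k = t - 1 by omega]

end Driven

/-! ### Decay rates -/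

theorem sqrt_sqrt_le_sqrt (T : ℕ) : √√(T : ℝ) ≤ √(T : ℝ) := by
  rcases Nat.eq_zero_or_pos T with rfl | hT
  · simp
  · have : 1 ≤ √(T : ℝ) := Real.one_le_sqrt.2 (by exact_mod_cast hT)
    exact Real.sqrt_le_iff.2 ⟨by linarith, by nlinarith⟩

theorem sqrt_le_natCast (T : ℕ) : √(T : ℝ) ≤ T := by
  rcases Nat.eq_zero_or_pos T with rfl | hT
  · simp
  · have : (1 : ℝ) ≤ T := by exact_mod_cast hT
    exact Real.sqrt_le_iff.2 ⟨by linarith, by nlinarith⟩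

theorem isBigO_exp_sqrt_sqrt {c : ℝ} (hc : 0 < c) :
    (fun T : ℕ => Real.exp (-c * √√(T : ℝ))) =O[atTop] fun T : ℕ => 1 / ((T : ℝ) + 1) ^ 4 := by
  have hy : Tendsto (fun T : ℕ => √√(T : ℝ)) atTop atTop :=
    Real.tendsto_sqrt_atTop.comp (Real.tendsto_sqrt_atTop.comp tendsto_natCast_atTop_atTop)
  refine ((isLittleO_exp_neg_mul_rpow_atTop hc (-(16 : ℕ))).comp_tendsto hy).isBigO.trans ?_
  refine Asymptotics.IsBigO.of_bound 16 ?_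
  filter_upwards [eventually_ge_atTop 1] with T hT
  have hT' : (1 : ℝ) ≤ T := by exact_mod_cast hT
  -- The exponent `16` turns decay in `T ^ (1/4)` into `T ^ (-4)`; the constant `16` is `2 ^ 4`,
  -- from `T + 1 ≤ 2 * T`.
  have h16 : √√(T : ℝ) ^ 16 = (T : ℝ) ^ 4 := by
    rw [show 16 = 2 * (2 * 4) by rfl, pow_mul, Real.sq_sqrt (Real.sqrt_nonneg _), pow_mul,
      Real.sq_sqrt (by positivity)]
  simp only [Function.comp]
  rw [Real.rpow_neg (Real.sqrt_nonneg _), Real.rpow_natCast, h16,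
    Real.norm_of_nonneg (by positivity), Real.norm_of_nonneg (by positivity), mul_one_div,
    inv_eq_one_div, div_le_div_iff₀ (by positivity) (by positivity)]
  calc 1 * ((T : ℝ) + 1) ^ 4 ≤ (2 * (T : ℝ)) ^ 4 := by
        rw [one_mul]
        exact pow_le_pow_left₀ (by positivity) (by linarith) 4
    _ = 16 * (T : ℝ) ^ 4 := by ring

theorem isBigO_of_le_exp {f : ℕ → ℝ} (hf : ∀ T, 0 ≤ f T) {c C : ℝ} (hc : 0 < c)
    (h : ∀ᶠ T : ℕ in atTop, f T ≤ C * Real.exp (-c * √√(T : ℝ))) :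
    f =O[atTop] fun T : ℕ => 1 / ((T : ℝ) + 1) ^ 4 := by
  refine (Asymptotics.IsBigO.of_bound |C| ?_).trans (isBigO_exp_sqrt_sqrt hc)
  filter_upwards [h] with T hT
  rw [Real.norm_of_nonneg (hf T), Real.norm_of_nonneg (Real.exp_pos _).le]
  exact hT.trans (mul_le_mul_of_nonneg_right (le_abs_self C) (Real.exp_pos _).le)

/-- The comparison function never vanishes on `ℕ`, thanks to the shift `T + 1`, so the asymptotic
bound holds for all `T` after enlarging the constant. -/
theorem exists_le_of_isBigO {f : ℕ → ℝ}
    (h : f =O[atTop] fun T : ℕ => 1 / ((T : ℝ) + 1) ^ 4) :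
    ∃ C, 0 ≤ C ∧ ∀ T : ℕ, f T ≤ C / ((T : ℝ) + 1) ^ 4 := by
  obtain ⟨C, hC⟩ := (Asymptotics.isBigO_nat_atTop_iff fun T hT => by
    have : (0 : ℝ) < 1 / ((T : ℝ) + 1) ^ 4 := by positivity
    exact absurd hT this.ne').1 h
  refine ⟨|C|, abs_nonneg C, fun T => (le_abs_self _).trans ((hC T).trans ?_)⟩
  rw [Real.norm_of_nonneg (by positivity), mul_one_div]
  gcongr
  exact le_abs_self C

theorem summable_one_div_succ_pow_four : Summable fun T : ℕ => 1 / ((T : ℝ) + 1) ^ 4 := by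
  have := (summable_nat_add_iff 1).2 (Real.summable_one_div_nat_pow.2 (by norm_num : 1 < 4))
  simpa using this

/-! ### Large deviation events -/

section Events

variable {n : ℕ} {Ω : Type u} {X : ℕ → Fin n → Ω → ℕ}

/-- The event that some partial average over `τ ≥ τ₀` steps at node `i` is at least `K`. -/
def largeAverage (X : ℕ → Fin n → Ω → ℕ) (i : Fin n) (K : ℝ) (τ₀ : ℕ) : Set Ω :=
  {ω | ∃ τ, τ₀ ≤ τ ∧ ω ∈ {ω | τ * K ≤ (itemSum (fun s j => X s j ω) τ i : ℝ)}}

/-- The event that some partial average over `τ ≥ τ₀` steps at node `i` is at most `K`. -/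
def smallAverage (X : ℕ → Fin n → Ω → ℕ) (i : Fin n) (K : ℝ) (τ₀ : ℕ) : Set Ω :=
  {ω | ∃ τ, τ₀ ≤ τ ∧ ω ∈ {ω | (itemSum (fun s j => X s j ω) τ i : ℝ) ≤ τ * K}}

theorem measurable_itemSum [MeasurableSpace Ω] (h : ∀ s i, Measurable (X s i)) (τ : ℕ)
    (i : Fin n) : Measurable fun ω => (itemSum (fun s j => X s j ω) τ i : ℝ) := by
  simp only [itemSum]
  exact measurable_from_nat.comp (Finset.measurable_sum _ fun s _ => h s i)

theorem measurableSet_largeAverage [MeasurableSpace Ω] (h : ∀ s i, Measurable (X s i))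
    (i : Fin n) (K : ℝ) (τ₀ : ℕ) : MeasurableSet (largeAverage X i K τ₀) := by
  have : largeAverage X i K τ₀ = ⋃ τ, ⋃ (_ : τ₀ ≤ τ),
      {ω | τ * K ≤ (itemSum (fun s j => X s j ω) τ i : ℝ)} := by
    ext ω
    simp [largeAverage]
  rw [this]
  exact MeasurableSet.iUnion fun τ => MeasurableSet.iUnion fun _ =>
    measurableSet_le measurable_const (measurable_itemSum h τ i)

theorem measurableSet_smallAverage [MeasurableSpace Ω] (h : ∀ s i, Measurable (X s i))
    (i : Fin n) (K : ℝ) (τ₀ : ℕ) : MeasurableSet (smallAverage X i K τ₀) := by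
  have : smallAverage X i K τ₀ = ⋃ τ, ⋃ (_ : τ₀ ≤ τ),
      {ω | (itemSum (fun s j => X s j ω) τ i : ℝ) ≤ τ * K} := by
    ext ω
    simp [smallAverage]
  rw [this]
  exact MeasurableSet.iUnion fun τ => MeasurableSet.iUnion fun _ =>
    measurableSet_le (measurable_itemSum h τ i) measurable_const

end Events

namespace IsItemProcess

variable {n : ℕ} {Ω : Type u} [MeasurableSpace Ω] {μ : Measure Ω} [IsProbabilityMeasure μ]
  {π : Fin n → ℝ} {X : ℕ → Fin n → Ω → ℕ}

theorem isBigO_smallAverage (hX : IsItemProcess μ π X) {i : Fin n} (hi : 0 < π i) :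
    (fun T : ℕ => μ.real (smallAverage X i (π i / 2) (T + 1))) =O[atTop]
      fun T : ℕ => 1 / ((T : ℝ) + 1) ^ 4 := by
  set c := π i * (1 / 2 - Real.exp (-1)) with hc
  have hc0 : 0 < c := mul_pos hi (by linarith [Real.exp_neg_one_lt_d9])
  refine isBigO_of_le_exp (fun _ => measureReal_nonneg) hc0
    (C := 1 / (1 - Real.exp (-c))) (Eventually.of_forall fun T => ?_)
  have h1 : Real.exp (-c) < 1 := Real.exp_lt_one_iff.2 (by linarith)
  refine (measureReal_iUnion_le_of_le_pow (Real.exp_pos _).le h1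
    (fun τ => hX.measureReal_itemSum_le τ i) (T + 1)).trans ?_
  rw [one_div_mul_eq_div]
  refine div_le_div_of_nonneg_right ?_ (by linarith)
  rw [← Real.exp_nat_mul, Real.exp_le_exp]
  have := (sqrt_sqrt_le_sqrt T).trans (sqrt_le_natCast T)
  push_cast
  nlinarith

theorem isBigO_largeAverage (hX : IsItemProcess μ π X) (hπ : ∀ i, 0 ≤ π i) (i : Fin n) :
    (fun T : ℕ => μ.real (largeAverage X i (2 * π i + 1) (T + 1))) =O[atTop]
      fun T : ℕ => 1 / ((T : ℝ) + 1) ^ 4 := by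
  refine isBigO_of_le_exp (fun _ => measureReal_nonneg) one_pos
    (C := 1 / (1 - Real.exp (-(2 * π i + 1 - 2 * π i)))) (Eventually.of_forall fun T => ?_)
  have h1 : Real.exp (-(2 * π i + 1 - 2 * π i)) < 1 := Real.exp_lt_one_iff.2 (by linarith)
  refine (measureReal_iUnion_le_of_le_pow (Real.exp_pos _).le h1
    (fun τ => hX.measureReal_le_itemSum hπ _ τ i) (T + 1)).trans ?_
  rw [one_div_mul_eq_div]
  refine div_le_div_of_nonneg_right ?_ (by linarith)
  rw [← Real.exp_nat_mul, Real.exp_le_exp]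
  have := (sqrt_sqrt_le_sqrt T).trans (sqrt_le_natCast T)
  push_cast
  nlinarith

theorem isBigO_largeAverage_sqrt (hX : IsItemProcess μ π X) (hπ : ∀ i, 0 ≤ π i) (i : Fin n) :
    (fun T : ℕ => μ.real (largeAverage X i (√(T : ℝ)) 1)) =O[atTop]
      fun T : ℕ => 1 / ((T : ℝ) + 1) ^ 4 := by
  have hs : Tendsto (fun T : ℕ => √(T : ℝ)) atTop atTop :=
    Real.tendsto_sqrt_atTop.comp tendsto_natCast_atTop_atTop
  have he : Real.exp (-1) < 1 := Real.exp_lt_one_iff.2 (by norm_num)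
  refine isBigO_of_le_exp (fun _ => measureReal_nonneg) one_pos
    (C := Real.exp (2 * π i) / (1 - Real.exp (-1))) ?_
  filter_upwards [hs.eventually_ge_atTop (2 * π i + 1)] with T hT
  have h1 : Real.exp (-(√(T : ℝ) - 2 * π i)) ≤ Real.exp (-1) := Real.exp_le_exp.2 (by linarith)
  refine (measureReal_iUnion_le_of_le_pow (Real.exp_pos _).le (h1.trans_lt he)
    (fun τ => hX.measureReal_le_itemSum hπ _ τ i) 1).trans ?_
  rw [div_mul_eq_mul_div, ← Real.exp_add, pow_one]
  refine div_le_div₀ (Real.exp_pos _).le (Real.exp_le_exp.2 ?_) (by linarith) (by linarith)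
  linarith [sqrt_sqrt_le_sqrt T]

end IsItemProcess

/-! ### Adaptive -/

/-- The conditional probability that Adaptive probes node `i` at time `t + 1`. -/
noncomputable abbrev adaptiveProb {n : ℕ} {Ω : Type u}
    (X : ℕ → Fin n → Ω → ℕ) (A : ℕ → Ω → Fin n) (i : Fin n) (t : ℕ)
    (ω : Ω) : ℝ :=
  probeProb (fun x a t => sqrtProbs (estimate x a t)) X A i t ω

section Adaptive

variable {n : ℕ} {Ω : Type u} [MeasurableSpace Ω] {μ : Measure Ω} [IsProbabilityMeasure μ]
  {π : Fin n → ℝ} {X : ℕ → Fin n → Ω → ℕ} {A : ℕ → Ω → Fin n}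

namespace IsAdaptive

theorem measureReal_noProbe_le (hA : IsAdaptive μ X A) (hX : IsItemProcess μ π X)
    (i : Fin n) {T : ℕ} (hT : 1 ≤ T) :
    μ.real (noProbe A i T (2 * T)) ≤ ∑ j, μ.real (largeAverage X j (√(T : ℝ)) 1) +
      Real.exp (-(1 / (2 * n)) * √√(T : ℝ)) := by
  set y := √√(T : ℝ) with hy
  have hT' : (1 : ℝ) ≤ T := by exact_mod_cast hT
  have hn : (1 : ℝ) ≤ n := by exact_mod_cast i.pos
  have hs1 : 1 ≤ √(T : ℝ) := Real.one_le_sqrt.2 hT'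
  have hy1 : 1 ≤ y := Real.one_le_sqrt.2 hs1
  have hy2 : √(T : ℝ) = y ^ 2 := (Real.sq_sqrt (Real.sqrt_nonneg _)).symm
  have hy4 : (T : ℝ) = y ^ 4 := by
    rw [show 4 = 2 * 2 by rfl, pow_mul, ← hy2, Real.sq_sqrt (by positivity)]
  set B : Set Ω := ⋃ j, largeAverage X j (√(T : ℝ)) 1 with hB
  have hBm : ∀ t, MeasurableSet[history X A t] B := fun t => MeasurableSet.iUnion fun j =>
    @measurableSet_largeAverage n Ω X (history X A t)
      (fun s i => measurable_history_item s i t) j _ 1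
  have hBm0 : MeasurableSet B := history_le hX.measurable hA.measurable 0 _ (hBm 0)
  -- The shape matches `le_sqrtProbs` with upper bound `√T` and lower bound `1 / (4 * T)`. The
  -- estimates are even at least `1 / (2 * T)`, but this weaker bound is a perfect square in `y`.
  set δ : ℝ := √((1 / (2 * y ^ 2)) ^ 2) / (n * √(√(T : ℝ))) with hδ
  have hδ' : δ = 1 / (2 * n * y ^ 3) := by
    rw [hδ, Real.sqrt_sq (by positivity), ← hy]
    field_simp
  have hδ1 : δ ≤ 1 := by
    rw [hδ', div_le_one (by positivity)]
    nlinarith [one_le_pow₀ hy1 (n := 3)]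
  have hprob : ∀ r, T ≤ r → r < T + T → ∀ ω, Bᶜ.indicator (fun _ => (1 : ℝ)) ω ≠ 0 →
      δ ≤ adaptiveProb X A i r ω := by
    intro r hr1 hr2 ω hω
    have hωB : ω ∉ B := fun h => hω (Set.indicator_of_notMem (not_not.2 h) _)
    simp only [hB, Set.mem_iUnion, largeAverage, Set.mem_ofPred_eq, not_exists, not_and,
      not_le] at hωB
    have hr : (r : ℝ) ≤ 2 * T := by exact_mod_cast (by omega : r ≤ 2 * T)
    refine le_sqrtProbs (by positivity) ?_ fun j =>
      estimate_le _ _ hs1 fun τ hτ => (hωB j τ hτ).le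
    have h1 := one_le_mul_estimate (fun s j => X s j ω) (fun r => A r ω)
      (hT.trans hr1) i
    have h2 := estimate_pos (fun s j => X s j ω) (fun r => A r ω) r i
    rw [div_pow, one_pow, div_le_iff₀ (by positivity), mul_pow, ← pow_mul, ← hy4]
    nlinarith
  have hint : Integrable (Bᶜ.indicator fun _ => (1 : ℝ)) μ :=
    (integrable_const _).indicator hBm0.compl
  have key := IsDrivenBy.setIntegral_noProbe_le hA hX.measurable
    (Z := Bᶜ.indicator fun _ => (1 : ℝ)) (a := T) (m := T)
    (fun t _ => stronglyMeasurable_const.indicator (hBm t).compl) hint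
    (fun ω => Set.indicator_nonneg (fun _ _ => zero_le_one) ω) hδ1 hprob
  rw [← two_mul, setIntegral_indicator hBm0.compl, integral_indicator hBm0.compl] at key
  simp only [integral_const, smul_eq_mul, mul_one, measureReal_restrict_apply_univ] at key
  have h1 : μ.real (noProbe A i T (2 * T)) ≤ μ.real B +
      μ.real (noProbe A i T (2 * T) ∩ Bᶜ) := by
    refine (measureReal_mono fun ω hω => ?_).trans (measureReal_union_le _ _)
    by_cases h : ω ∈ B
    · exact Or.inl h
    · exact Or.inr ⟨hω, h⟩
  have h2 : (1 - δ) ^ T * μ.real Bᶜ ≤ Real.exp (-(1 / (2 * n)) * y) := by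
    refine (mul_le_of_le_one_right (pow_nonneg (by linarith) _) measureReal_le_one).trans ?_
    -- Here `T * δ = y ^ 4 / (2 * n * y ^ 3) = y / (2 * n)`.
    calc (1 - δ) ^ T ≤ Real.exp (-δ) ^ T :=
          pow_le_pow_left₀ (by linarith) (Real.one_sub_le_exp_neg δ) T
      _ = Real.exp (-(1 / (2 * n)) * y) := by
          rw [← Real.exp_nat_mul, hδ', hy4]
          congr 1
          field_simp
  exact h1.trans (add_le_add (measureReal_iUnion_fintype_le _) (key.trans h2))

theorem isBigO_noProbe (hA : IsAdaptive μ X A) (hX : IsItemProcess μ π X)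
    (hπ : ∀ i, 0 ≤ π i) (i : Fin n) :
    (fun T : ℕ => μ.real (noProbe A i T (2 * T))) =O[atTop]
      fun T : ℕ => 1 / ((T : ℝ) + 1) ^ 4 := by
  have hn : (0 : ℝ) < n := by exact_mod_cast i.pos
  refine Asymptotics.IsBigO.trans (Asymptotics.IsBigO.of_bound 1 ?_)
    ((Asymptotics.IsBigO.fun_sum fun j (_ : j ∈ Finset.univ) =>
      hX.isBigO_largeAverage_sqrt hπ j).add
      (isBigO_exp_sqrt_sqrt (c := 1 / (2 * n)) (by positivity)))
  filter_upwards [eventually_ge_atTop 1] with T hT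
  rw [one_mul, Real.norm_of_nonneg measureReal_nonneg]
  exact (hA.measureReal_noProbe_le hX i hT).trans (le_abs_self _)

theorem ae_frequently_probe (hA : IsAdaptive μ X A) (hX : IsItemProcess μ π X)
    (hπ : ∀ i, 0 ≤ π i) (i : Fin n) : ∀ᵐ ω ∂μ, ∀ lo, ∃ r, lo < r ∧ A r ω = i := by
  obtain ⟨C, hC0, hC⟩ := exists_le_of_isBigO (hA.isBigO_noProbe hX hπ i)
  have hsum : ∑' T, μ (noProbe A i T (2 * T)) ≠ ∞ := by
    have hs : Summable fun T => μ.real (noProbe A i T (2 * T)) := by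
      refine Summable.of_nonneg_of_le (fun _ => measureReal_nonneg) hC ?_
      simpa only [mul_one_div] using summable_one_div_succ_pow_four.mul_left C
    have h1 : ∀ T, μ (noProbe A i T (2 * T)) =
        ENNReal.ofReal (μ.real (noProbe A i T (2 * T))) := fun T =>
      (ENNReal.ofReal_toReal (measure_ne_top _ _)).symm
    simp_rw [h1]
    rw [← ENNReal.ofReal_tsum_of_nonneg (fun _ => measureReal_nonneg) hs]
    exact ENNReal.ofReal_ne_top
  filter_upwards [ae_eventually_notMem hsum] with ω hω lo
  obtain ⟨T, hT, hlo⟩ := (hω.and (eventually_ge_atTop lo)).exists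
  simp only [noProbe, Set.mem_ofPred_eq] at hT
  push Not at hT
  obtain ⟨r, hr, hri⟩ := hT
  exact ⟨r, hlo.trans_lt (Finset.mem_Ioc.1 hr).1, hri⟩

theorem ae_tendsto_adaptiveProb (hA : IsAdaptive μ X A) (hX : IsItemProcess μ π X)
    (hπ : ∀ i, 0 ≤ π i) (hsum : 0 < ∑ j, √(π j)) (i : Fin n) :
    ∀ᵐ ω ∂μ, Tendsto (fun t => adaptiveProb X A i t ω) atTop (𝓝 (sqrtProbs π i)) := by
  filter_upwards [ae_all_iff.2 fun j => hX.ae_tendsto_average j,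
    ae_all_iff.2 fun j => hA.ae_frequently_probe hX hπ j] with ω h1 h2
  exact tendsto_sqrtProbs hsum (fun j => tendsto_estimate _ _ (hπ j) (h1 j) (h2 j)) i

end IsAdaptive

end Adaptive

/-! ### A uniform lower bound on Adaptive's probe probabilities off a bad event -/

section BadEvent

variable {n : ℕ} {Ω : Type u}

/-- The event that at some time `≥ 2 * T` the probability that Adaptive probes node `i` may be far
from its limit. -/
def badEvent (π : Fin n → ℝ) (X : ℕ → Fin n → Ω → ℕ) (A : ℕ → Ω → Fin n) (i : Fin n) (T : ℕ) :
    Set Ω :=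
  smallAverage X i (π i / 2) (T + 1) ∪
    ((⋃ j, largeAverage X j (2 * π j + 1) (T + 1)) ∪ ⋃ j, noProbe A j T (2 * T))

/-- The averages involve items of the whole future, but those belong to every `history`; only the
probes up to `2 * T` restrict `t`. -/
theorem measurableSet_badEvent (π : Fin n → ℝ) (X : ℕ → Fin n → Ω → ℕ) (A : ℕ → Ω → Fin n)
    (i : Fin n) {T t : ℕ} (h : 2 * T ≤ t) :
    MeasurableSet[history X A t] (badEvent π X A i T) := by
  have hm : ∀ s i, Measurable[history X A t] (X s i) := fun s i => measurable_history_item s i t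
  exact (@measurableSet_smallAverage n Ω X (history X A t) hm _ _ _).union
    ((MeasurableSet.iUnion fun j => @measurableSet_largeAverage n Ω X (history X A t) hm _ _ _).union
      (MeasurableSet.iUnion fun j => measurableSet_history_noProbe X j h))

/-- Off the bad event every node is probed in `(T, 2T]`, so from time `2T` on each estimate is an
average over more than `T` steps. That of `i` is then at least `π i / 2`, and all are at most `M`.
The minimum with `1 / 2` only ensures `δ < 1`. -/
theorem exists_le_adaptiveProb {π : Fin n → ℝ} (hπ : ∀ i, 0 ≤ π i) {i : Fin n} (hi : 0 < π i)
    (X : ℕ → Fin n → Ω → ℕ) (A : ℕ → Ω → Fin n) :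
    ∃ δ, 0 < δ ∧ δ < 1 ∧ ∀ T r ω, ω ∉ badEvent π X A i T → 2 * T ≤ r →
      δ ≤ adaptiveProb X A i r ω := by
  set M := 2 * (∑ j, π j) + 1 with hM
  have hM1 : 1 ≤ M := by linarith [Finset.sum_nonneg fun j (_ : j ∈ Finset.univ) => hπ j]
  have hn : (0 : ℝ) < n := by exact_mod_cast i.pos
  have hδ0 : 0 < √(π i / 2) / (n * √M) := by positivity
  refine ⟨min (√(π i / 2) / (n * √M)) (1 / 2), lt_min hδ0 (by norm_num),
    (min_le_right _ _).trans_lt (by norm_num), fun T r ω hω hr => (min_le_left _ _).trans ?_⟩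
  simp only [badEvent, Set.mem_union, Set.mem_iUnion, not_or, not_exists, smallAverage,
    largeAverage, noProbe, Set.mem_ofPred_eq, not_and, not_le] at hω
  obtain ⟨h1, h2, h3⟩ := hω
  have h4 : ∀ j, ∃ τ ∈ Finset.Ioc T r, estimate (fun s j => X s j ω) (fun r => A r ω) r j =
      empirical (fun s j => X s j ω) τ j := by
    intro j
    have h5 := h3 j
    push Not at h5
    obtain ⟨r', hr', h6⟩ := h5
    rw [Finset.mem_Ioc] at hr'
    exact estimate_eq_empirical _ _ (Finset.mem_Ioc.2 ⟨hr'.1, hr'.2.trans hr⟩) h6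
  refine le_sqrtProbs (by positivity) ?_ fun j => ?_
  · obtain ⟨τ, hτ, he⟩ := h4 i
    rw [Finset.mem_Ioc] at hτ
    rw [he]
    exact le_empirical _ (by omega) (h1 τ (by omega)).le
  · obtain ⟨τ, hτ, he⟩ := h4 j
    rw [Finset.mem_Ioc] at hτ
    rw [he]
    refine empirical_le _ hM1 (by omega) ((h2 j τ (by omega)).le.trans ?_)
    refine mul_le_mul_of_nonneg_left ?_ (Nat.cast_nonneg τ)
    linarith [Finset.single_le_sum (fun j _ => hπ j) (Finset.mem_univ j)]

end BadEvent

/-! ### The limit of the expected number of undiscovered items under Adaptive -/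

section Limit

variable {n : ℕ} {Ω : Type u} [MeasurableSpace Ω] {μ : Measure Ω}
  {π : Fin n → ℝ} {X : ℕ → Fin n → Ω → ℕ} {A : ℕ → Ω → Fin n}

theorem IsItemProcess.meanUndiscovered_eq_zero (hX : IsItemProcess μ π X) {i : Fin n}
    (hi : π i = 0) (S : ℕ → Ω → Fin n) (t : ℕ) : meanUndiscovered μ X S t i = 0 := by
  refine Finset.sum_eq_zero fun k _ => le_antisymm ?_ (integral_nonneg fun _ => Nat.cast_nonneg _)
  refine (setIntegral_le_integral (hX.integrable _ i)
    (Eventually.of_forall fun _ => Nat.cast_nonneg _)).trans ?_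
  rw [hX.integral_eq, hi]

theorem hasSum_one_sub_pow_mul {c : ℝ} (hc : 0 < c) (hc1 : c ≤ 1) (z : ℝ) :
    HasSum (fun k => (1 - c) ^ k * z) (z / c) := by
  have := (hasSum_geometric_of_lt_one (sub_nonneg.2 hc1) (by linarith : 1 - c < 1)).mul_right z
  rwa [sub_sub_cancel, inv_mul_eq_div] at this

theorem summable_pow_half {q : ℝ} (hq : 0 < q) (hq1 : q < 1) :
    Summable fun k : ℕ => q ^ (k / 2) := by
  set s := √q with hs
  have hs0 : 0 < s := Real.sqrt_pos.2 hq
  have hs1 : s < 1 := by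
    rw [hs, Real.sqrt_lt' one_pos]
    linarith
  refine Summable.of_nonneg_of_le (fun k => by positivity) (fun k => ?_)
    ((summable_geometric_of_lt_one hs0.le hs1).div_const s)
  rw [le_div_iff₀ hs0, ← Real.sq_sqrt hq.le, ← hs, ← pow_mul, ← pow_succ]
  exact pow_le_pow_of_le_one hs0.le hs1.le (by omega)

theorem mul_le_mul_sq_add (x d : ℝ) {ε : ℝ} (hε : 0 < ε) : x * d ≤ ε * x ^ 2 + ε⁻¹ * d ^ 2 := by
  have h : ε * x ^ 2 + ε⁻¹ * d ^ 2 - x * d = ε⁻¹ * ((ε * x - d / 2) ^ 2 + 3 / 4 * d ^ 2) := by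
    field_simp
    ring
  have : 0 ≤ ε⁻¹ * ((ε * x - d / 2) ^ 2 + 3 / 4 * d ^ 2) := by positivity
  linarith

namespace IsAdaptive

variable [IsProbabilityMeasure μ]

theorem tendsto_integral_sq (hA : IsAdaptive μ X A) (hX : IsItemProcess μ π X)
    (hπ : ∀ i, 0 ≤ π i) (hsum : 0 < ∑ j, √(π j)) (i : Fin n) :
    Tendsto (fun t => ∫ ω, (adaptiveProb X A i t ω - sqrtProbs π i) ^ 2 ∂μ) atTop (𝓝 0) := by
  have h := tendsto_integral_of_dominated_convergence (μ := μ)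
    (F := fun t ω => (adaptiveProb X A i t ω - sqrtProbs π i) ^ 2) (f := fun _ => (0 : ℝ))
    (fun _ => (1 : ℝ))
    (fun t => ((IsDrivenBy.aestronglyMeasurable_probeProb hA hX.measurable i t).sub
      aestronglyMeasurable_const).pow 2) (integrable_const _)
    (fun t => Eventually.of_forall fun ω => ?_) ?_
  · simpa using h
  · rw [Real.norm_of_nonneg (sq_nonneg _), sq_le_one_iff_abs_le_one, abs_le]
    have h1 := sqrtProbs_nonneg (estimate (fun s j => X s j ω) (fun r => A r ω) t) i
    have h2 := sqrtProbs_le_one (estimate (fun s j => X s j ω) (fun r => A r ω) t) i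
    have h3 := sqrtProbs_nonneg π i
    have h4 := sqrtProbs_le_one π i
    simp only [probeProb]
    constructor <;> linarith
  · filter_upwards [hA.ae_tendsto_adaptiveProb hX hπ hsum i] with ω hω
    simpa using (hω.sub_const (sqrtProbs π i)).pow 2

/-- The item count may be unbounded and influences the later estimates, so neither boundedness nor
independence separates the factors. Instead `x * d ≤ ε * x ^ 2 + ε⁻¹ * d ^ 2` uses the constant
second moment and the mean-square convergence of the probabilities. -/
theorem tendsto_integral_item_mul (hA : IsAdaptive μ X A) (hX : IsItemProcess μ π X)
    (hπ : ∀ i, 0 ≤ π i) (hsum : 0 < ∑ j, √(π j)) (i : Fin n) (m : ℕ) :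
    Tendsto (fun a => ∫ ω, (X a i ω : ℝ) * |adaptiveProb X A i (a + m) ω - sqrtProbs π i| ∂μ)
      atTop (𝓝 0) := by
  obtain ⟨V, hV0, hV⟩ := hX.exists_integral_sq_eq i
  have hD := (tendsto_add_atTop_iff_nat m).2 (hA.tendsto_integral_sq hX hπ hsum i)
  rw [Metric.tendsto_atTop]
  intro η hη
  -- `V + 1` rather than `V`, as the second moment can vanish.
  set ε := η / (2 * (V + 1)) with hε
  have hε0 : 0 < ε := by positivity
  obtain ⟨N, hN⟩ := Metric.tendsto_atTop.1 hD (ε * (η / 2)) (by positivity)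
  refine ⟨N, fun a ha => ?_⟩
  have hN := hN a ha
  rw [Real.dist_0_eq_abs, abs_of_nonneg (integral_nonneg fun _ => by positivity)] at hN ⊢
  have hm := (IsDrivenBy.aestronglyMeasurable_probeProb hA hX.measurable i (a + m)).sub
    (aestronglyMeasurable_const (b := sqrtProbs π i))
  have hb : ∀ ω, |adaptiveProb X A i (a + m) ω - sqrtProbs π i| ≤ 1 := by
    intro ω
    have h1 := sqrtProbs_nonneg (estimate (fun s j => X s j ω) (fun r => A r ω) (a + m)) i
    have h2 := sqrtProbs_le_one (estimate (fun s j => X s j ω) (fun r => A r ω) (a + m)) i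
    have h3 := sqrtProbs_nonneg π i
    have h4 := sqrtProbs_le_one π i
    rw [abs_le]
    simp only [probeProb]
    constructor <;> linarith
  have hi2 : Integrable (fun ω => (adaptiveProb X A i (a + m) ω - sqrtProbs π i) ^ 2) μ := by
    refine (integrable_const (1 : ℝ)).mono' (hm.pow 2) (Eventually.of_forall fun ω => ?_)
    rw [Real.norm_of_nonneg (sq_nonneg _), sq_le_one_iff_abs_le_one]
    exact hb ω
  have hle : ∫ ω, (X a i ω : ℝ) * |adaptiveProb X A i (a + m) ω - sqrtProbs π i| ∂μ ≤
      ∫ ω, (ε * (X a i ω : ℝ) ^ 2 +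
        ε⁻¹ * (adaptiveProb X A i (a + m) ω - sqrtProbs π i) ^ 2) ∂μ := by
    refine integral_mono_of_nonneg (Eventually.of_forall fun ω => by positivity)
      (((hX.integrable_pow 2 a i).const_mul ε).add (hi2.const_mul ε⁻¹))
      (Eventually.of_forall fun ω => ?_)
    simp only
    rw [← sq_abs (adaptiveProb X A i (a + m) ω - sqrtProbs π i)]
    exact mul_le_mul_sq_add (X a i ω : ℝ) _ hε0
  rw [integral_add ((hX.integrable_pow 2 a i).const_mul ε) (hi2.const_mul ε⁻¹),
    integral_const_mul, integral_const_mul, hV] at hle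
  have h1 : ε * V < η / 2 := by
    rw [hε, div_mul_eq_mul_div, div_lt_div_iff₀ (by positivity) two_pos]
    nlinarith
  have h2 : ε⁻¹ * ∫ ω, (adaptiveProb X A i (a + m) ω - sqrtProbs π i) ^ 2 ∂μ < η / 2 := by
    rw [inv_mul_lt_iff₀ hε0]
    exact hN
  linarith

theorem exists_measureReal_badEvent_le (hA : IsAdaptive μ X A) (hX : IsItemProcess μ π X)
    (hπ : ∀ i, 0 ≤ π i) {i : Fin n} (hi : 0 < π i) :
    ∃ C, 0 ≤ C ∧ ∀ T : ℕ, μ.real (badEvent π X A i T) ≤ C / ((T : ℝ) + 1) ^ 4 := by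
  refine exists_le_of_isBigO (Asymptotics.IsBigO.trans (Asymptotics.IsBigO.of_bound 1 ?_)
    ((hX.isBigO_smallAverage hi).add
    ((Asymptotics.IsBigO.fun_sum fun j (_ : j ∈ Finset.univ) => hX.isBigO_largeAverage hπ j).add
    (Asymptotics.IsBigO.fun_sum fun j (_ : j ∈ Finset.univ) => hA.isBigO_noProbe hX hπ j))))
  refine Eventually.of_forall fun T => ?_
  rw [one_mul, Real.norm_of_nonneg measureReal_nonneg]
  refine le_trans ?_ (le_abs_self _)
  exact (measureReal_union_le _ _).trans (add_le_add le_rfl ((measureReal_union_le _ _).trans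
    (add_le_add (measureReal_iUnion_fintype_le _) (measureReal_iUnion_fintype_le _))))

theorem setIntegral_noProbe_le_of_badEvent (hA : IsAdaptive μ X A) (hX : IsItemProcess μ π X)
    {i : Fin n} {δ C V : ℝ} (hδ0 : 0 < δ) (hδ1 : δ < 1)
    (hδ : ∀ T r ω, ω ∉ badEvent π X A i T → 2 * T ≤ r → δ ≤ adaptiveProb X A i r ω)
    (hC0 : 0 ≤ C) (hC : ∀ T : ℕ, μ.real (badEvent π X A i T) ≤ C / ((T : ℝ) + 1) ^ 4)
    (hV : ∀ s, ∫ ω, (X s i ω : ℝ) ^ 2 ∂μ = V) (hi : 0 ≤ π i) {t k : ℕ} (hk : k < t) :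
    ∫ ω in noProbe A i (t - 1 - k) (t - 1 - k + k), (X (t - 1 - k) i ω : ℝ) ∂μ ≤
      (1 - δ) ^ (k / 2) * π i + (V + 256 * C) * (1 / ((k : ℝ) + 1) ^ 2) := by
  set s := t - 1 - k with hs
  -- With this `T`, the interval from `max s (2 * T)` to `t - 1` contains at least `k / 2` probes
  -- for every age `k < t`, while `k + 1 ≤ 4 * (T + 1)` makes the bad event small in terms of `k`.
  set T := t / 4 with hT
  set a := max s (2 * T) with ha
  obtain ⟨m, hm⟩ : ∃ m, s + k = a + m := ⟨s + k - a, by omega⟩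
  have hmk : k / 2 ≤ m := by omega
  have hBm : ∀ r, a ≤ r → MeasurableSet[history X A r] (badEvent π X A i T) := fun r hr =>
    measurableSet_badEvent π X A i (by omega)
  have hle := history_le hX.measurable hA.measurable
  have hB := hle _ _ (hBm a le_rfl)
  have hN : ∀ a b, MeasurableSet (noProbe A i a b) := measurableSet_noProbe hA.measurable i
  have hXi := hX.integrable s i
  set B := badEvent π X A i T with hBdef
  have hX0 : ∀ ω, 0 ≤ (X s i ω : ℝ) := fun ω => Nat.cast_nonneg _
  have hgood : ∫ ω in noProbe A i a (a + m), Bᶜ.indicator (fun ω => (X s i ω : ℝ)) ω ∂μ ≤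
      (1 - δ) ^ m * ∫ ω, Bᶜ.indicator (fun ω => (X s i ω : ℝ)) ω ∂μ := by
    refine IsDrivenBy.setIntegral_noProbe_le hA hX.measurable (fun r hr => ?_)
      (hXi.indicator hB.compl) (fun ω => Set.indicator_nonneg (fun ω _ => hX0 ω) ω) hδ1.le
      fun r hr _ ω hω => hδ T r ω (fun h => hω (Set.indicator_of_notMem (not_not.2 h) _))
        (by omega)
    have hmeas : Measurable[history X A r] fun ω => (X s i ω : ℝ) :=
      measurable_from_nat.comp (measurable_history_item s i r)
    exact hmeas.stronglyMeasurable.indicator (hBm r hr).compl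
  have hgood' : ∫ ω, Bᶜ.indicator (fun ω => (X s i ω : ℝ)) ω ∂μ ≤ π i := by
    rw [← hX.integral_eq s i]
    exact integral_mono (hXi.indicator hB.compl) hXi
      fun ω => Set.indicator_le_self' (fun ω _ => hX0 ω) ω
  have hpow : (1 - δ) ^ m ≤ (1 - δ) ^ (k / 2) :=
    pow_le_pow_of_le_one (by linarith) (by linarith) hmk
  have hbad : ∫ ω in noProbe A i a (a + m), B.indicator (fun ω => (X s i ω : ℝ)) ω ∂μ ≤
      (V + 256 * C) * (1 / ((k : ℝ) + 1) ^ 2) := by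
    -- This balances the terms: the bad event has probability at most `256 * C * ε ^ 2`, where `256
    -- = 4 ^ 4`, so `ε * V` and `ε⁻¹ * μ.real B` are both `O(ε)` and summable in `k`.
    set ε : ℝ := 1 / ((k : ℝ) + 1) ^ 2 with hε
    have hε0 : 0 < ε := by positivity
    have h1 : ∫ ω, B.indicator (fun ω => (X s i ω : ℝ)) ω ∂μ ≤
        ∫ ω, (ε * (X s i ω : ℝ) ^ 2 + ε⁻¹ * B.indicator (fun _ => (1 : ℝ)) ω) ∂μ := by
      refine integral_mono (hXi.indicator hB) (((hX.integrable_pow 2 s i).const_mul ε).add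
        (((integrable_const _).indicator hB).const_mul ε⁻¹)) fun ω => ?_
      by_cases h : ω ∈ B
      · simp only [Set.indicator_of_mem h]
        simpa using mul_le_mul_sq_add (X s i ω : ℝ) 1 hε0
      · simp only [Set.indicator_of_notMem h, mul_zero, add_zero]
        positivity
    rw [integral_add ((hX.integrable_pow 2 s i).const_mul ε)
      (((integrable_const _).indicator hB).const_mul ε⁻¹), integral_const_mul,
      integral_const_mul, hV, integral_indicator_const _ hB, smul_eq_mul, mul_one] at h1
    have h2 : μ.real B ≤ 256 * C * (ε * ε) := by
      refine (hC T).trans ?_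
      have hkT : (k : ℝ) + 1 ≤ 4 * (T + 1) := by exact_mod_cast (by omega : k + 1 ≤ 4 * (T + 1))
      have h4 : ((k : ℝ) + 1) ^ 4 ≤ (4 * ((T : ℝ) + 1)) ^ 4 :=
        pow_le_pow_left₀ (by positivity) hkT 4
      have h5 : 256 * C * (ε * ε) = 256 * C / ((k : ℝ) + 1) ^ 4 := by
        rw [hε]
        field_simp
      rw [h5, div_le_div_iff₀ (by positivity) (by positivity)]
      rw [mul_pow] at h4
      nlinarith
    have h3 : ε⁻¹ * μ.real B ≤ 256 * C * ε := by
      rw [inv_mul_le_iff₀ hε0]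
      linarith
    have h4 := setIntegral_le_integral (s := noProbe A i a (a + m)) (hXi.indicator hB)
      (Eventually.of_forall fun ω => Set.indicator_nonneg (fun ω _ => hX0 ω) ω)
    linarith
  calc _ ≤ ∫ ω in noProbe A i a (a + m), (X s i ω : ℝ) ∂μ := by
        refine setIntegral_mono_set hXi.integrableOn (Eventually.of_forall hX0)
          (LE.le.eventuallyLE (noProbe_mono A i (by omega) (by omega)))
    _ = ∫ ω in noProbe A i a (a + m), (Bᶜ.indicator (fun ω => (X s i ω : ℝ)) ω +
          B.indicator (fun ω => (X s i ω : ℝ)) ω) ∂μ := by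
        refine integral_congr_ae (Eventually.of_forall fun ω => ?_)
        exact (congrFun (Set.indicator_compl_add_self B fun ω => (X s i ω : ℝ)) ω).symm
    _ ≤ _ := by
        rw [integral_add (hXi.indicator hB.compl).integrableOn (hXi.indicator hB).integrableOn]
        refine add_le_add (hgood.trans ?_) hbad
        exact (mul_le_mul_of_nonneg_left hgood' (pow_nonneg (by linarith) _)).trans
          (mul_le_mul_of_nonneg_right hpow hi)

theorem tendsto_meanUndiscovered (hA : IsAdaptive μ X A) (hX : IsItemProcess μ π X)
    (hπ : ∀ i, 0 ≤ π i) (hsum : 0 < ∑ j, √(π j)) (i : Fin n) :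
    Tendsto (fun t => meanUndiscovered μ X A t i) atTop (𝓝 (π i / sqrtProbs π i)) := by
  rcases (hπ i).eq_or_lt with hi | hi
  -- A node without items: the claimed limit is `0 / 0`, which is `0` by convention.
  · simp [hX.meanUndiscovered_eq_zero hi.symm, ← hi]
  have hc : 0 < sqrtProbs π i := div_pos (Real.sqrt_pos.2 hi) hsum
  obtain ⟨V, hV0, hV⟩ := hX.exists_integral_sq_eq i
  obtain ⟨C, hC0, hC⟩ := hA.exists_measureReal_badEvent_le hX hπ hi
  obtain ⟨δ, hδ0, hδ1, hδ⟩ := exists_le_adaptiveProb hπ hi X A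
  rw [← (hasSum_one_sub_pow_mul hc (sqrtProbs_le_one π i) (π i)).tsum_eq]
  have hb : Summable fun k : ℕ =>
      (1 - δ) ^ (k / 2) * π i + (V + 256 * C) * (1 / ((k : ℝ) + 1) ^ 2) := by
    refine ((summable_pow_half (by linarith) (by linarith)).mul_right _).add
      (Summable.mul_left _ ?_)
    simpa using (summable_nat_add_iff 1).2
      (Real.summable_one_div_nat_pow.2 (by norm_num : 1 < 2))
  have key := tendsto_tsum_of_dominated_convergence (𝓕 := atTop)
    (f := fun t k => if k < t then
      ∫ ω in noProbe A i (t - 1 - k) (t - 1 - k + k), (X (t - 1 - k) i ω : ℝ) ∂μ else 0)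
    (g := fun k => (1 - sqrtProbs π i) ^ k * π i) hb (fun k => ?_)
    (Eventually.of_forall fun t k => ?_)
  · refine key.congr fun t => ?_
    rw [meanUndiscovered, tsum_eq_sum (s := Finset.range t)]
    · exact Finset.sum_congr rfl fun k hk => if_pos (Finset.mem_range.1 hk)
    · exact fun k hk => if_neg fun h => hk (Finset.mem_range.2 h)
  · have h1 := IsDrivenBy.tendsto_setIntegral_noProbe hA hX.measurable
      (Z := fun a ω => (X a i ω : ℝ)) (fun a t => ?_) (fun a => hX.integrable a i)
      (fun a ω => Nat.cast_nonneg _) (fun a => hX.integral_eq a i)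
      (hA.tendsto_integral_item_mul hX hπ hsum i) k
    · have h2 := h1.comp ((tendsto_sub_atTop_nat k).comp (tendsto_sub_atTop_nat 1))
      refine h2.congr' ?_
      filter_upwards [eventually_gt_atTop k] with t ht
      rw [if_pos ht]
      rfl
    · exact (measurable_from_nat.comp (measurable_history_item a i t)).stronglyMeasurable
  · split_ifs with h
    · rw [Real.norm_of_nonneg (integral_nonneg fun _ => Nat.cast_nonneg _)]
      exact hA.setIntegral_noProbe_le_of_badEvent hX hδ0 hδ1 hδ hC0 hC hV hi.le h
    · rw [norm_zero]
      have : 0 ≤ 1 - δ := by linarith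
      positivity

end IsAdaptive

end Limit

/-! ### Costs, and optimality among memoryless schedules -/

section Cost

variable {n : ℕ} {Ω : Type u} [MeasurableSpace Ω] {μ : Measure Ω}
  {π : Fin n → ℝ} {X : ℕ → Fin n → Ω → ℕ} {S : ℕ → Ω → Fin n}

theorem sum_div_sqrtProbs (π : Fin n → ℝ) :
    ∑ i, π i / sqrtProbs π i = (∑ i, √(π i)) ^ 2 := by
  have h : ∀ i, π i / sqrtProbs π i = √(π i) * ∑ j, √(π j) := by
    intro i
    rw [sqrtProbs, div_div_eq_mul_div, mul_div_right_comm, Real.div_sqrt]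
  simp_rw [h]
  rw [← Finset.sum_mul, sq]

theorem IsItemProcess.meanUndiscovered_of_isMemoryless [IsProbabilityMeasure μ]
    (hX : IsItemProcess μ π X) {p : Fin n → ℝ} (hS : IsMemoryless μ p X S) (t : ℕ) (i : Fin n) :
    meanUndiscovered μ X S t i = ∑ k ∈ Finset.range t, (1 - p i) ^ k * π i := by
  refine Finset.sum_congr rfl fun k _ => ?_
  rw [hS.drivenBy.setIntegral_noProbe_eq hX.measurable
    (Z := fun ω => (X (t - 1 - k) i ω : ℝ))
    (fun r _ => (measurable_from_nat.comp (measurable_history_item _ i r)).stronglyMeasurable)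
    (hX.integrable _ i) (c := p i) (fun _ _ => rfl), hX.integral_eq]

theorem IsItemProcess.tendsto_meanUndiscovered_of_isMemoryless [IsProbabilityMeasure μ]
    (hX : IsItemProcess μ π X) {p : Fin n → ℝ} (hS : IsMemoryless μ p X S) {i : Fin n}
    (h : π i = 0 ∨ 0 < p i) :
    Tendsto (fun t => meanUndiscovered μ X S t i) atTop (𝓝 (π i / p i)) := by
  rcases h with h | h
  · simp [hX.meanUndiscovered_eq_zero h, h]
  · simp_rw [hX.meanUndiscovered_of_isMemoryless hS]
    refine (hasSum_one_sub_pow_mul h ?_ (π i)).tendsto_sum_nat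
    rw [← hS.mem_stdSimplex.2]
    exact Finset.single_le_sum (fun j _ => hS.mem_stdSimplex.1 j) (Finset.mem_univ i)

theorem sum_Icc_expectedUndiscovered_div (hX : IsItemProcess μ π X) (hS : ∀ t, Measurable (S t))
    {t : ℕ} (ht : 0 < t) :
    (∑ t' ∈ Finset.Icc 1 t, expectedUndiscovered μ X S t') / (t : ℝ≥0∞) =
      ENNReal.ofReal ((t : ℝ)⁻¹ * ∑ m ∈ Finset.range t, ∑ i, meanUndiscovered μ X S (m + 1) i) := by
  have h0 : ∀ m, 0 ≤ ∑ i, meanUndiscovered μ X S m i := fun m =>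
    Finset.sum_nonneg fun i _ => meanUndiscovered_nonneg μ X S m i
  have h1 : Finset.Icc 1 t = Finset.Ico 1 (t + 1) := by
    ext
    simp only [Finset.mem_Icc, Finset.mem_Ico]
    omega
  simp_rw [hX.expectedUndiscovered_eq hS]
  rw [← ENNReal.ofReal_sum_of_nonneg fun m _ => h0 m, h1, Finset.sum_Ico_eq_sum_range,
    Nat.add_sub_cancel, inv_mul_eq_div, ENNReal.ofReal_div_of_pos (by exact_mod_cast ht),
    ENNReal.ofReal_natCast]
  simp_rw [add_comm 1]

theorem IsItemProcess.hasCost (hX : IsItemProcess μ π X) (hS : ∀ t, Measurable (S t)) {c : ℝ}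
    (h : Tendsto (fun t => ∑ i, meanUndiscovered μ X S t i) atTop (𝓝 c)) :
    HasCost μ X S (ENNReal.ofReal c) := by
  have h1 := ((tendsto_add_atTop_iff_nat 1).2 h).cesaro
  refine (ENNReal.tendsto_ofReal h1).congr' ?_
  filter_upwards [eventually_gt_atTop 0] with t ht
  exact (sum_Icc_expectedUndiscovered_div hX hS ht).symm

/-- A one-sided comparison, since the cost of a memoryless schedule may be infinite and its node
sums need not converge. -/
theorem IsItemProcess.ofReal_le_of_hasCost (hX : IsItemProcess μ π X)
    (hS : ∀ t, Measurable (S t)) {f : ℕ → ℝ} {c : ℝ} {c' : ℝ≥0∞} (hc' : HasCost μ X S c')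
    (hf : ∀ t, f t ≤ ∑ i, meanUndiscovered μ X S t i) (h : Tendsto f atTop (𝓝 c)) :
    ENNReal.ofReal c ≤ c' := by
  have h1 := ((tendsto_add_atTop_iff_nat 1).2 h).cesaro
  refine le_of_tendsto_of_tendsto (ENNReal.tendsto_ofReal h1) hc' ?_
  filter_upwards [eventually_gt_atTop 0] with t ht
  rw [sum_Icc_expectedUndiscovered_div hX hS ht]
  refine ENNReal.ofReal_le_ofReal (mul_le_mul_of_nonneg_left ?_ (by positivity))
  exact Finset.sum_le_sum fun m _ => hf _

theorem sq_sum_sqrt_le (hπ : ∀ i, 0 ≤ π i) {q : Fin n → ℝ} (hq : ∀ i, 0 < q i) :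
    (∑ i, √(π i)) ^ 2 ≤ (∑ i, π i / q i) * ∑ i, q i := by
  refine Finset.sum_sq_le_sum_mul_sum_of_sq_le_mul _ (fun i _ => div_nonneg (hπ i) (hq i).le)
    (fun i _ => (hq i).le) fun i _ => ?_
  rw [Real.sq_sqrt (hπ i), div_mul_cancel₀ _ (hq i).ne']

/-- The cost of every memoryless schedule is at least `(∑ i, √(π i)) ^ 2`. -/
theorem IsItemProcess.ofReal_sq_sum_sqrt_le_of_isMemoryless [IsProbabilityMeasure μ]
    (hX : IsItemProcess μ π X) (hπ : ∀ i, 0 ≤ π i) {q : Fin n → ℝ} (hS : IsMemoryless μ q X S)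
    {c' : ℝ≥0∞} (hc' : HasCost μ X S c') : ENNReal.ofReal ((∑ i, √(π i)) ^ 2) ≤ c' := by
  have hq0 := hS.mem_stdSimplex.1
  have hq1 := hS.mem_stdSimplex.2
  have hqle : ∀ i, q i ≤ 1 := fun i => by
    rw [← hq1]
    exact Finset.single_le_sum (fun j _ => hq0 j) (Finset.mem_univ i)
  have key : ∀ ε : ℝ, 0 < ε → ε < 1 →
      ENNReal.ofReal ((∑ i, √(π i)) ^ 2 / (1 + n * ε)) ≤ c' := by
    intro ε hε hε1
    -- Nodes with `q i = 0` are handled by replacing `q i` with `q i + ε * (1 - q i)`. This is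
    -- positive and at least `q i`, so it only lowers each term `(1 - q i) ^ k * π i`; the total
    -- weight grows to at most `1 + n * ε`, and Cauchy–Schwarz loses just that factor.
    have hq'0 : ∀ i, 0 < 1 - (1 - q i) * (1 - ε) := fun i => by
      nlinarith [hq0 i, hqle i]
    have hq'1 : ∀ i, 1 - (1 - q i) * (1 - ε) ≤ 1 := fun i => by
      nlinarith [hq0 i, hqle i]
    have hsum : ∑ i, (1 - (1 - q i) * (1 - ε)) ≤ 1 + n * ε := by
      calc _ ≤ ∑ i, (q i + ε) := Finset.sum_le_sum fun i _ => by nlinarith [hq0 i]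
        _ = 1 + n * ε := by simp [Finset.sum_add_distrib, hq1]
    refine le_trans (ENNReal.ofReal_le_ofReal ?_) (hX.ofReal_le_of_hasCost hS.drivenBy.measurable
      hc' (f := fun t => ∑ i, ∑ k ∈ Finset.range t, (1 - (1 - (1 - q i) * (1 - ε))) ^ k * π i)
      (fun t => Finset.sum_le_sum fun i _ => ?_)
      (tendsto_finsetSum _ fun i _ =>
        (hasSum_one_sub_pow_mul (hq'0 i) (hq'1 i) (π i)).tendsto_sum_nat))
    · rw [div_le_iff₀ (by positivity)]
      refine (sq_sum_sqrt_le hπ hq'0).trans (mul_le_mul_of_nonneg_left hsum ?_)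
      exact Finset.sum_nonneg fun i _ => div_nonneg (hπ i) (hq'0 i).le
    · rw [hX.meanUndiscovered_of_isMemoryless hS]
      refine Finset.sum_le_sum fun k _ => mul_le_mul_of_nonneg_right ?_ (hπ i)
      refine pow_le_pow_left₀ ?_ ?_ k
      · rw [sub_sub_cancel]
        exact mul_nonneg (by linarith [hqle i]) (by linarith)
      · nlinarith [hqle i]
  have hlim : Tendsto (fun ε : ℝ => ENNReal.ofReal ((∑ i, √(π i)) ^ 2 / (1 + n * ε))) (𝓝[>] 0)
      (𝓝 (ENNReal.ofReal ((∑ i, √(π i)) ^ 2))) := by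
    have h1 : Tendsto (fun ε : ℝ => (∑ i, √(π i)) ^ 2 / (1 + n * ε)) (𝓝 0)
        (𝓝 ((∑ i, √(π i)) ^ 2 / (1 + n * 0))) :=
      tendsto_const_nhds.div (tendsto_const_nhds.add (tendsto_id.const_mul _)) (by simp)
    rw [mul_zero, add_zero, div_one] at h1
    exact ENNReal.tendsto_ofReal (h1.mono_left nhdsWithin_le_nhds)
  refine le_of_tendsto hlim ?_
  filter_upwards [Ioo_mem_nhdsGT (zero_lt_one (α := ℝ))] with ε hε
  exact key ε hε.1 hε.2

end Cost

end Probing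

theorem mainTheorem7 {n : ℕ} (π : Fin n → ℝ) (hπ : ∀ i, 0 ≤ π i) (hpos : ∃ i, 0 < π i)
    {Ω : Type u} [MeasurableSpace Ω] (μ : Measure Ω) [IsProbabilityMeasure μ]
    (X : ℕ → Fin n → Ω → ℕ) (hX : Probing.IsItemProcess μ π X)
    (A : ℕ → Ω → Fin n) (hA : Probing.IsAdaptive μ X A)
    {Ω' : Type v} [MeasurableSpace Ω'] (μ' : Measure Ω') [IsProbabilityMeasure μ']
    (Y : ℕ → Fin n → Ω' → ℕ) (hY : Probing.IsItemProcess μ' π Y)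
    (R : ℕ → Ω' → Fin n) (hR : Probing.IsMemoryless μ' (Probing.sqrtProbs π) Y R) :
    Probing.IsOptimalMemoryless.{v, w} μ' π Y R ∧
    Probing.Converges μ X A μ' Y R ∧
    Probing.HasCost μ X A (ENNReal.ofReal ((∑ i, √(π i)) ^ 2)) ∧
    Probing.HasCost μ' Y R (ENNReal.ofReal ((∑ i, √(π i)) ^ 2)) := by
  have hsum : 0 < ∑ j, √(π j) := by
    obtain ⟨i, hi⟩ := hpos
    exact Finset.sum_pos' (fun _ _ => Real.sqrt_nonneg _)
      ⟨i, Finset.mem_univ i, Real.sqrt_pos.2 hi⟩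
  have hlimA : Tendsto (fun t => ∑ i, Probing.meanUndiscovered μ X A t i) atTop
      (𝓝 ((∑ i, √(π i)) ^ 2)) := by
    rw [← Probing.sum_div_sqrtProbs π]
    exact tendsto_finsetSum _ fun i _ => hA.tendsto_meanUndiscovered hX hπ hsum i
  have hlimR : Tendsto (fun t => ∑ i, Probing.meanUndiscovered μ' Y R t i) atTop
      (𝓝 ((∑ i, √(π i)) ^ 2)) := by
    rw [← Probing.sum_div_sqrtProbs π]
    refine tendsto_finsetSum _ fun i _ =>
      hY.tendsto_meanUndiscovered_of_isMemoryless hR ?_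
    rcases (hπ i).eq_or_lt with h | h
    · exact Or.inl h.symm
    · exact Or.inr (div_pos (Real.sqrt_pos.2 h) hsum)
  have hmA : ∀ t, Measurable (A t) := Probing.IsDrivenBy.measurable hA
  have hmR := hR.drivenBy.measurable
  have hcostR := hY.hasCost hmR hlimR
  refine ⟨⟨⟨_, hR⟩, _, hcostR, ?_⟩, ⟨fun t => ?_, fun t => ?_, ?_⟩, hX.hasCost hmA hlimA, hcostR⟩
  · intro Ω'' _ μ'' _ X' S q c' hX' hS hc'
    exact hX'.ofReal_sq_sum_sqrt_le_of_isMemoryless hπ hS hc'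
  · rw [hX.expectedUndiscovered_eq hmA]
    exact ENNReal.ofReal_ne_top
  · rw [hY.expectedUndiscovered_eq hmR]
    exact ENNReal.ofReal_ne_top
  · simp_rw [hX.expectedUndiscovered_eq hmA, hY.expectedUndiscovered_eq hmR]
    have h0 : ∀ t, 0 ≤ ∑ i, Probing.meanUndiscovered μ X A t i := fun t =>
      Finset.sum_nonneg fun i _ => Probing.meanUndiscovered_nonneg μ X A t i
    have h1 : ∀ t, 0 ≤ ∑ i, Probing.meanUndiscovered μ' Y R t i := fun t =>
      Finset.sum_nonneg fun i _ => Probing.meanUndiscovered_nonneg μ' Y R t i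
    simp_rw [ENNReal.toReal_ofReal (h0 _), ENNReal.toReal_ofReal (h1 _)]
    simpa using (hlimA.sub hlimR).abs
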